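/- Theorem 2. Let $(\mathcal X,\Delta)$ be a metric space equipped with a probability measure $\mu$, and let $f^*:\mathcal X\to[K]=\{1,\dots,K\}$ be a ground-truth labelling. Let $\nu_d$ be the standard Gaussian measure on $\mathbb R^d$ with its Euclidean norm, and suppose that $\mu=\sum_{i=1}^K p_i\,\mu_i$, where $\mu_i=(g_i)_*\nu_d$ for maps $g_i:\mathbb R^d\to\mathcal X$, $p_i\in[0,1]$ and $\sum_i p_i=1$. Write $\mathcal B(\cdot,\rho)$ for closed balls of radius $\rho$. For a classifier $f:\mathcal X\to[K]$, a probability measure $\lambda$ on $\mathcal X$ and $\epsilon>0$ put $$\mathrm{Risk}_\lambda(f)=\Pr_{x\sim\lambda}[f(x)\ne f^*(x)],\qquad \mathrm{AdvRisk}^\epsilon_\mu(f)=\Pr_{x\sim\mu}\big[\exists\,x'\in\mathcal B(x,\epsilon):\ f(x')\neq f^*(x')\big],$$ and for a class $\mathcal F$ of classifiers let $\mathrm{Rob}^\epsilon_\mu(\mathcal F)=1-\inf_{f\in\mathcal F}\mathrm{AdvRisk}^\epsilon_\mu(f)$ be its intrinsic robustness (with $\inf\emptyset=+\infty$). Let $\epsilon>0$,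 $r>0$, $\delta\in(0,1]$ and, for $i\in[K]$, let $L_i(r)$ be constants such that $r\,L_i(r)\ge\epsilon$ and $$\Pr_{z\sim\nu_d}\big[\forall z'\in\mathcal B(z,r):\ \Delta(g_i(z'),g_i(z))\le L_i(r)\,\|z'-z\|_2\big]\ \ge\ 1-\delta .$$ Let $L_{\max}(r)=\max_i L_i(r)$ and $\alpha>0$. Let $\Phi$ be the distribution function of $\mathcal N(0,1)$ and $\Phi^{-1}$ its inverse, with $\Phi(\pm\infty)$ and $\Phi^{-1}(0)=-\infty$, $\Phi^{-1}(1)=+\infty$ understood as limits. (i) Let $\mathcal F_\alpha=\{f:\mathrm{Risk}_\mu(f)\ge\alpha\}$. If $p_i>0$ and $\alpha/p_i\le 1$ for every $i\in[K]$, then $$\mathrm{Rob}^\epsilon_\mu(\mathcal F_\alpha)\ \le\ 1+\delta-\min_{i\in[K]}\Big\{p_i\,\Phi\Big(\Phi^{-1}\Big(\frac{\alpha}{p_i}\Big)+\frac{\epsilon}{L_{\max}(r)}\Big)\Big\}.$$ (ii) Let $\tilde{\mathcal F}_\alpha=\{f:\mathrm{Risk}_{\mu_i}(f)\ge\alpha\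 \text{for all } i\in[K]\}$. Then $$\mathrm{Rob}^\epsilon_\mu(\tilde{\mathcal F}_\alpha)\ \le\ 1+\delta-\sum_{i=1}^K p_i\,\Phi\Big(\Phi^{-1}(\alpha)+\frac{\epsilon}{L_{\max}(r)}\Big).$$ (If $\alpha>1$ the class in (ii) is empty and the bound is trivial.) -/

import Mathlib

open MeasureTheory ProbabilityTheory

noncomputable section

namespace IntrinsicRobustness

/-- The distribution function `Φ` of the standard normal law on the line, extended to
`[-∞, +∞]` by `Φ(-∞) = 0` and `Φ(+∞) = 1`. -/
def gaussCDF (x : EReal) : ℝ :=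
  (gaussianReal 0 1).real {u : ℝ | (u : EReal) ≤ x}

/-- The inverse `Φ⁻¹ : [0, 1] → [-∞, +∞]` of `Φ`, with `Φ⁻¹(0) = -∞` and `Φ⁻¹(1) = +∞`. -/
def gaussQuantile (a : ℝ) : EReal :=
  sInf {x : EReal | a ≤ gaussCDF x}

/-- The standard Gaussian law `ν_d` on `ℝ^d` with the Euclidean norm. -/
abbrev latentLaw (d : ℕ) : Measure (EuclideanSpace ℝ (Fin d)) :=
  stdGaussian (EuclideanSpace ℝ (Fin d))

/-- `Risk_μ(f) = Pr_{x ∼ μ} [f(x) ≠ f*(x)]`. -/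
def risk {X : Type*} [MeasurableSpace X] {K : ℕ} (μ : Measure X) (fstar f : X → Fin K) : ℝ :=
  μ.real {x | f x ≠ fstar x}

/-- `AdvRisk_μ^ε(f) = Pr_{x ∼ μ} [∃ x' ∈ B(x, ε), f(x') ≠ f*(x')]`, with closed balls. -/
def advRisk {X : Type*} [MetricSpace X] [MeasurableSpace X] {K : ℕ}
    (μ : Measure X) (fstar : X → Fin K) (ε : ℝ) (f : X → Fin K) : ℝ :=
  μ.real {x | ∃ x' ∈ Metric.closedBall x ε, f x' ≠ fstar x'}

/-- Intrinsic robustness `1 - inf_{f ∈ F} AdvRisk_μ^ε(f)` of a class `F` of classifiers.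
It is extended-real valued only to give the infimum over an empty class its usual value `+∞`. -/
def intrinsicRob {X : Type*} [MetricSpace X] [MeasurableSpace X] {K : ℕ}
    (μ : Measure X) (fstar : X → Fin K) (ε : ℝ) (F : Set (X → Fin K)) : EReal :=
  1 - ⨅ f ∈ F, (advRisk μ fstar ε f : EReal)

/-- The (measurable) classifiers of risk at least `α`. -/
def imperfect {X : Type*} [MeasurableSpace X] {K : ℕ}
    (μ : Measure X) (fstar : X → Fin K) (α : ℝ) : Set (X → Fin K) :=
  {f | Measurable f ∧ α ≤ risk μ fstar f}

/-- The conditional law `μ_i = (g_i)_* ν_d` of the images generated by `g_i`. -/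
def condLaw {X : Type*} [MeasurableSpace X] {d : ℕ}
    (g : EuclideanSpace ℝ (Fin d) → X) : Measure X :=
  (latentLaw d).map g

/-- The (measurable) classifiers whose conditional risk is at least `α` for every class. -/
def classwiseImperfect {X : Type*} [MeasurableSpace X] {K d : ℕ}
    (g : Fin K → EuclideanSpace ℝ (Fin d) → X) (fstar : X → Fin K) (α : ℝ) :
    Set (X → Fin K) :=
  {f | Measurable f ∧ ∀ i, α ≤ risk (condLaw (g i)) fstar f}

/-- `μ` is generated by the conditional generative model `{(g_i, p_i)}`:
`μ = ∑ i, p_i · (g_i)_* ν_d`. -/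
structure IsGeneratedBy {X : Type*} [MeasurableSpace X] {K d : ℕ} (μ : Measure X)
    (g : Fin K → EuclideanSpace ℝ (Fin d) → X) (p : Fin K → ℝ) : Prop where
  measurable : ∀ i, Measurable (g i)
  nonneg : ∀ i, 0 ≤ p i
  sum_eq_one : ∑ i, p i = 1
  eq_mixture : μ = ∑ i, ENNReal.ofReal (p i) • condLaw (g i)

/-- `g` is `L`-locally Lipschitz at scale `r` with probability at least `1 - δ`. -/
def LocallyLipschitzWithProb {X : Type*} [MetricSpace X] {d : ℕ}
    (g : EuclideanSpace ℝ (Fin d) → X) (r L δ : ℝ) : Prop :=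
  1 - δ ≤ (latentLaw d).real
    {z | ∀ z' ∈ Metric.closedBall z r, dist (g z') (g z) ≤ L * ‖z' - z‖}

end IntrinsicRobustness

end

noncomputable section

namespace IntrinsicRobustness

open Filter Set Topology
open scoped RealInnerProductSpace

/-! ### The normal distribution function and its inverse -/

/-- The standard normal density. -/
abbrev gaussPDF (x : ℝ) : ℝ := gaussianPDFReal 0 1 x

lemma gaussPDF_eq (x : ℝ) : gaussPDF x = (√(2 * Real.pi))⁻¹ * Real.exp (-x ^ 2 / 2) := by
  simp [gaussPDF, gaussianPDFReal]

lemma gaussPDF_pos (x : ℝ) : 0 < gaussPDF x := gaussianPDFReal_pos 0 1 x one_ne_zero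

lemma gaussPDF_le_one (x : ℝ) : gaussPDF x ≤ 1 := by
  rw [gaussPDF_eq]
  have h1 : 1 ≤ √(2 * Real.pi) := by
    rw [Real.one_le_sqrt]; nlinarith [Real.pi_gt_three]
  have h2 : Real.exp (-x ^ 2 / 2) ≤ 1 := by
    rw [Real.exp_le_one_iff]; nlinarith [sq_nonneg x]
  calc _ ≤ 1 * 1 := mul_le_mul (inv_le_one_of_one_le₀ h1) h2 (Real.exp_pos _).le zero_le_one
    _ = 1 := one_mul 1

lemma continuous_gaussPDF : Continuous gaussPDF := by
  rw [show gaussPDF = _ from funext gaussPDF_eq]; fun_prop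

lemma hasDerivAt_gaussPDF (x : ℝ) : HasDerivAt gaussPDF (-x * gaussPDF x) x := by
  have h := (((hasDerivAt_pow 2 x).neg.div_const 2).exp).const_mul ((√(2 * Real.pi))⁻¹)
  rw [show gaussPDF = _ from funext gaussPDF_eq]
  refine h.congr_deriv ?_
  simp only [Pi.neg_apply]
  ring

lemma gaussPDF_add (w c : ℝ) : gaussPDF (w + c) = gaussPDF w * Real.exp (-c * w - c ^ 2 / 2) := by
  rw [gaussPDF_eq, gaussPDF_eq, mul_assoc, ← Real.exp_add]
  congr 2
  ring

lemma abs_mul_gaussPDF_le_one (x : ℝ) : |x * gaussPDF x| ≤ 1 := by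
  rw [gaussPDF_eq, abs_mul, abs_of_pos (a := _ * _) (by positivity)]
  have h1 : 1 ≤ √(2 * Real.pi) := by
    rw [Real.one_le_sqrt]; nlinarith [Real.pi_gt_three]
  have h2 : |x| ≤ Real.exp (x ^ 2 / 2) := by
    have := Real.add_one_le_exp (x ^ 2 / 2)
    nlinarith [sq_abs x, sq_nonneg (|x| - 1)]
  have h3 : Real.exp (-x ^ 2 / 2) = (Real.exp (x ^ 2 / 2))⁻¹ := by
    rw [← Real.exp_neg, neg_div]
  rw [h3]
  have h4 : |x| * (Real.exp (x ^ 2 / 2))⁻¹ ≤ 1 := by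
    rw [← div_eq_mul_inv, div_le_one (Real.exp_pos _)]; exact h2
  calc _ = (√(2 * Real.pi))⁻¹ * (|x| * (Real.exp (x ^ 2 / 2))⁻¹) := by ring
    _ ≤ 1 * 1 := mul_le_mul (inv_le_one_of_one_le₀ h1) h4 (by positivity) zero_le_one
    _ = 1 := one_mul 1

lemma gaussCDF_coe (x : ℝ) : gaussCDF x = (gaussianReal 0 1).real (Iic x) := by
  simp [gaussCDF, Iic]

@[simp] lemma gaussCDF_bot : gaussCDF ⊥ = 0 := by simp [gaussCDF]

@[simp] lemma gaussCDF_top : gaussCDF ⊤ = 1 := by simp [gaussCDF]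

lemma gaussCDF_nonneg (x : EReal) : 0 ≤ gaussCDF x := measureReal_nonneg

lemma gaussCDF_le_one (x : EReal) : gaussCDF x ≤ 1 := measureReal_le_one

lemma gaussCDF_mono : Monotone gaussCDF := fun _ _ h ↦
  measureReal_mono fun _ hu ↦ le_trans hu h

lemma gaussCDF_eq_integral (x : ℝ) : gaussCDF x = ∫ u in Iic x, gaussPDF u := by
  rw [gaussCDF_coe, measureReal_def, gaussianReal_apply_eq_integral 0 one_ne_zero,
    ENNReal.toReal_ofReal]
  exact integral_nonneg fun u ↦ (gaussPDF_pos u).le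

lemma gaussCDF_sub (x y : ℝ) :
    gaussCDF y - gaussCDF x = ∫ u in x..y, gaussPDF u := by
  rw [gaussCDF_eq_integral, gaussCDF_eq_integral]
  exact intervalIntegral.integral_Iic_sub_Iic (integrable_gaussianPDFReal 0 1).integrableOn
    (integrable_gaussianPDFReal 0 1).integrableOn

lemma hasDerivAt_gaussCDF (x : ℝ) : HasDerivAt (fun y : ℝ ↦ gaussCDF y) (gaussPDF x) x := by
  have h := intervalIntegral.integral_hasDerivAt_right (a := 0) (b := x) (f := gaussPDF)
    (continuous_gaussPDF.intervalIntegrable _ _)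
    (continuous_gaussPDF.stronglyMeasurableAtFilter _ _) continuous_gaussPDF.continuousAt
  have h2 : (fun y : ℝ ↦ gaussCDF y) = fun y : ℝ ↦ gaussCDF (0 : ℝ) + ∫ u in (0 : ℝ)..y, gaussPDF u := by
    funext y; rw [← gaussCDF_sub]; ring
  rw [h2]; exact h.const_add _

lemma strictMono_gaussCDF_coe : StrictMono fun y : ℝ ↦ gaussCDF y :=
  strictMono_of_deriv_pos fun x ↦ by rw [(hasDerivAt_gaussCDF x).deriv]; exact gaussPDF_pos x

lemma continuous_gaussCDF_coe : Continuous fun y : ℝ ↦ gaussCDF y :=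
  continuous_iff_continuousAt.2 fun x ↦ (hasDerivAt_gaussCDF x).continuousAt

lemma gaussCDF_eq_cdf (x : ℝ) : gaussCDF x = cdf (gaussianReal 0 1) x := by
  rw [gaussCDF_coe, cdf_eq_real]

lemma tendsto_gaussCDF_atBot : Tendsto (fun y : ℝ ↦ gaussCDF y) atBot (𝓝 0) := by
  simp_rw [gaussCDF_eq_cdf]; exact tendsto_cdf_atBot _

lemma tendsto_gaussCDF_atTop : Tendsto (fun y : ℝ ↦ gaussCDF y) atTop (𝓝 1) := by
  simp_rw [gaussCDF_eq_cdf]; exact tendsto_cdf_atTop _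

lemma gaussCDF_coe_pos (x : ℝ) : 0 < gaussCDF x :=
  (gaussCDF_nonneg _).trans_lt (strictMono_gaussCDF_coe (sub_one_lt x))

lemma gaussCDF_coe_lt_one (x : ℝ) : gaussCDF x < 1 :=
  (strictMono_gaussCDF_coe (lt_add_one x)).trans_le (gaussCDF_le_one _)

lemma exists_gaussCDF_eq {a : ℝ} (h0 : 0 < a) (h1 : a < 1) : ∃ x : ℝ, gaussCDF x = a :=
  mem_range_of_exists_le_of_exists_ge continuous_gaussCDF_coe
    (((tendsto_gaussCDF_atBot.eventually_lt_const h0).exists).imp fun _ h ↦ h.le)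
    (((tendsto_gaussCDF_atTop.eventually_const_lt h1).exists).imp fun _ h ↦ h.le)

lemma gaussCDF_strictMono : StrictMono gaussCDF := by
  intro x y h
  induction x with
  | bot => 
    induction y with
    | bot => exact absurd h (lt_irrefl _)
    | coe y => simpa using gaussCDF_coe_pos y
    | top => simp
  | coe x => 
    induction y with
    | bot => exact absurd h not_lt_bot
    | coe y => exact strictMono_gaussCDF_coe (by exact_mod_cast h)
    | top => simpa using gaussCDF_coe_lt_one x
  | top => exact absurd h not_top_lt

lemma gaussQuantile_gaussCDF (x : EReal) : gaussQuantile (gaussCDF x) = x := by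
  simp_rw [gaussQuantile, gaussCDF_strictMono.le_iff_le]
  exact csInf_Ici

lemma gaussQuantile_of_nonpos {a : ℝ} (h : a ≤ 0) : gaussQuantile a = ⊥ :=
  le_bot_iff.1 (sInf_le (by simpa using h))

lemma gaussQuantile_of_one_le {a : ℝ} (h : 1 ≤ a) : gaussQuantile a = ⊤ := by
  refine top_le_iff.1 (le_sInf fun x (hx : a ≤ gaussCDF x) ↦ ?_)
  exact gaussCDF_strictMono.le_iff_le.1 (by rw [gaussCDF_top]; linarith)

lemma gaussQuantile_mono : Monotone gaussQuantile := fun _ _ h ↦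
  sInf_le_sInf fun _ hx ↦ le_trans h hx

lemma continuous_gaussQuantile : Continuous gaussQuantile :=
  gaussQuantile_mono.continuous_of_surjective fun x ↦ ⟨_, gaussQuantile_gaussCDF x⟩

lemma exists_gaussCDF_eq' {a : ℝ} (h0 : 0 ≤ a) (h1 : a ≤ 1) : ∃ x : EReal, gaussCDF x = a := by
  rcases h0.eq_or_lt with rfl | h0
  · exact ⟨⊥, gaussCDF_bot⟩
  rcases h1.eq_or_lt with rfl | h1
  · exact ⟨⊤, gaussCDF_top⟩
  obtain ⟨x, hx⟩ := exists_gaussCDF_eq h0 h1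
  exact ⟨x, hx⟩

lemma continuous_gaussCDF : Continuous gaussCDF := by
  let F : EReal → Icc (0 : ℝ) 1 := fun x ↦ ⟨gaussCDF x, gaussCDF_nonneg x, gaussCDF_le_one x⟩
  have hF : Continuous F := by
    refine Monotone.continuous_of_surjective (fun x y h ↦ gaussCDF_mono h) fun ⟨a, h0, h1⟩ ↦ ?_
    obtain ⟨x, hx⟩ := exists_gaussCDF_eq' h0 h1
    exact ⟨x, Subtype.ext hx⟩
  exact (continuous_subtype_val.comp hF : Continuous fun x ↦ (F x : ℝ))

/-- `Φ(Φ⁻¹(a) + c)`: the mass of the `c`-neighbourhood of a half-space of Gaussian mass `a`. -/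
def gaussShift (c a : ℝ) : ℝ := gaussCDF (gaussQuantile a + (c : EReal))

lemma gaussShift_gaussCDF (c x : ℝ) : gaussShift c (gaussCDF x) = gaussCDF ((x + c : ℝ) : EReal) := by
  rw [gaussShift, gaussQuantile_gaussCDF, EReal.coe_add]

lemma gaussShift_of_nonpos (c : ℝ) {a : ℝ} (h : a ≤ 0) : gaussShift c a = 0 := by
  simp [gaussShift, gaussQuantile_of_nonpos h]

lemma gaussShift_of_one_le (c : ℝ) {a : ℝ} (h : 1 ≤ a) : gaussShift c a = 1 := by
  simp [gaussShift, gaussQuantile_of_one_le h]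

lemma gaussShift_nonneg (c a : ℝ) : 0 ≤ gaussShift c a := gaussCDF_nonneg _

lemma gaussShift_le_one (c a : ℝ) : gaussShift c a ≤ 1 := gaussCDF_le_one _

lemma gaussShift_mono (c : ℝ) : Monotone (gaussShift c) := fun _ _ h ↦
  gaussCDF_mono (add_le_add_left (gaussQuantile_mono h) _)

lemma continuous_gaussShift (c : ℝ) : Continuous (gaussShift c) := by
  refine continuous_gaussCDF.comp (continuous_iff_continuousAt.2 fun a ↦ ?_)
  exact (EReal.continuousAt_add (Or.inr (EReal.coe_ne_bot c)) (Or.inr (EReal.coe_ne_top c))).comp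
    (f := fun a ↦ (gaussQuantile a, (c : EReal)))
    (continuous_gaussQuantile.continuousAt.prodMk continuousAt_const)

lemma continuous_gaussShift_left (a : ℝ) : Continuous fun c ↦ gaussShift c a := by
  rcases le_or_gt a 0 with h0 | h0
  · simp_rw [gaussShift_of_nonpos _ h0]; exact continuous_const
  rcases le_or_gt 1 a with h1 | h1
  · simp_rw [gaussShift_of_one_le _ h1]; exact continuous_const
  obtain ⟨x, rfl⟩ := exists_gaussCDF_eq h0 h1
  simp_rw [gaussShift_gaussCDF]
  exact continuous_gaussCDF_coe.comp (continuous_const.add continuous_id)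

/-! ### Calculus of `gaussShift` -/

lemma gaussQuantile_toReal_gaussCDF (x : ℝ) : (gaussQuantile (gaussCDF x)).toReal = x := by
  rw [gaussQuantile_gaussCDF, EReal.toReal_coe]

lemma hasDerivAt_gaussQuantile (x : ℝ) :
    HasDerivAt (fun a ↦ (gaussQuantile a).toReal) (gaussPDF x)⁻¹ (gaussCDF x) := by
  refine HasDerivAt.of_local_left_inverse (f := fun y : ℝ ↦ gaussCDF y) ?_ ?_ (gaussPDF_pos x).ne' ?_
  · have h : ContinuousAt EReal.toReal (gaussQuantile (gaussCDF x)) := by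
      rw [gaussQuantile_gaussCDF]
      exact EReal.tendsto_toReal (EReal.coe_ne_top x) (EReal.coe_ne_bot x)
    exact h.comp (f := gaussQuantile) continuous_gaussQuantile.continuousAt
  · simpa only [gaussQuantile_toReal_gaussCDF] using hasDerivAt_gaussCDF x
  · filter_upwards [Ioo_mem_nhds (gaussCDF_coe_pos x) (gaussCDF_coe_lt_one x)] with a ha
    obtain ⟨y, rfl⟩ := exists_gaussCDF_eq ha.1 ha.2
    simp only [gaussQuantile_toReal_gaussCDF]

lemma gaussShift_eventuallyEq (c x : ℝ) :
    gaussShift c =ᶠ[𝓝 (gaussCDF x)]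
      fun a ↦ gaussCDF (((gaussQuantile a).toReal + c : ℝ) : EReal) := by
  filter_upwards [Ioo_mem_nhds (gaussCDF_coe_pos x) (gaussCDF_coe_lt_one x)] with a ha
  obtain ⟨y, rfl⟩ := exists_gaussCDF_eq ha.1 ha.2
  rw [gaussShift_gaussCDF, gaussQuantile_toReal_gaussCDF]

/-- The derivative of `gaussShift c` as a function of the quantile. -/
def gaussShiftDeriv (c a : ℝ) : ℝ := Real.exp (-c * (gaussQuantile a).toReal - c ^ 2 / 2)

/-- The second derivative of `gaussShift c` as a function of the quantile. -/
def gaussShiftDeriv₂ (c a : ℝ) : ℝ :=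
  -c * (gaussShiftDeriv c a * (gaussPDF (gaussQuantile a).toReal)⁻¹)

lemma hasDerivAt_gaussShift (c : ℝ) {a : ℝ} (ha : a ∈ Ioo 0 1) :
    HasDerivAt (gaussShift c) (gaussShiftDeriv c a) a := by
  obtain ⟨x, rfl⟩ := exists_gaussCDF_eq ha.1 ha.2
  refine HasDerivAt.congr_of_eventuallyEq ?_ (gaussShift_eventuallyEq c x)
  have h := (hasDerivAt_gaussCDF (x + c)).comp_of_eq (gaussCDF x)
    ((hasDerivAt_gaussQuantile x).add_const c) (by rw [gaussQuantile_toReal_gaussCDF])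
  refine h.congr_deriv ?_
  rw [gaussPDF_add, gaussShiftDeriv, gaussQuantile_toReal_gaussCDF]
  field_simp [(gaussPDF_pos x).ne']

lemma hasDerivAt_gaussShiftDeriv (c : ℝ) {a : ℝ} (ha : a ∈ Ioo 0 1) :
    HasDerivAt (gaussShiftDeriv c) (gaussShiftDeriv₂ c a) a := by
  obtain ⟨x, rfl⟩ := exists_gaussCDF_eq ha.1 ha.2
  have h := (((hasDerivAt_gaussQuantile x).const_mul (-c)).sub_const (c ^ 2 / 2)).exp
  refine h.congr_deriv ?_
  rw [gaussShiftDeriv₂, gaussShiftDeriv, gaussQuantile_toReal_gaussCDF]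
  ring

lemma hasDerivAt_gaussShiftDeriv₂ (c : ℝ) (x : ℝ) :
    HasDerivAt (gaussShiftDeriv₂ c)
      (-c * (x - c) * Real.exp (-c * x - c ^ 2 / 2) * ((gaussPDF x)⁻¹) ^ 2) (gaussCDF x) := by
  have h1 := hasDerivAt_gaussShiftDeriv c ⟨gaussCDF_coe_pos x, gaussCDF_coe_lt_one x⟩
  have h2 := (hasDerivAt_gaussPDF x).comp_of_eq (gaussCDF x) (hasDerivAt_gaussQuantile x)
    (gaussQuantile_toReal_gaussCDF x).symm
  have h3 := (h1.mul (h2.inv (by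
    simpa only [Function.comp, gaussQuantile_toReal_gaussCDF] using (gaussPDF_pos x).ne'))).const_mul (-c)
  refine h3.congr_deriv ?_
  have hp := (gaussPDF_pos x).ne'
  simp only [Pi.inv_apply, Function.comp_apply, gaussShiftDeriv₂, gaussShiftDeriv, gaussQuantile_toReal_gaussCDF]
  field_simp
  ring

lemma concaveOn_gaussShift {c : ℝ} (hc : 0 ≤ c) : ConcaveOn ℝ (Icc 0 1) (gaussShift c) := by
  refine AntitoneOn.concaveOn_of_deriv (convex_Icc 0 1) (continuous_gaussShift c).continuousOn ?_ ?_
  · rw [interior_Icc]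
    exact fun a ha ↦ (hasDerivAt_gaussShift c ha).differentiableAt.differentiableWithinAt
  · rw [interior_Icc]
    intro a ha b hb hab
    rw [(hasDerivAt_gaussShift c ha).deriv, (hasDerivAt_gaussShift c hb).deriv]
    obtain ⟨x, rfl⟩ := exists_gaussCDF_eq ha.1 ha.2
    obtain ⟨y, rfl⟩ := exists_gaussCDF_eq hb.1 hb.2
    have hxy : x ≤ y := strictMono_gaussCDF_coe.le_iff_le.1 hab
    simp only [gaussShiftDeriv, gaussQuantile_toReal_gaussCDF]
    exact Real.exp_le_exp.2 (by nlinarith)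

lemma mul_gaussShift_le {c l a : ℝ} (hc : 0 ≤ c) (hl : l ∈ Icc (0 : ℝ) 1) (ha : a ∈ Icc (0 : ℝ) 1) :
    l * gaussShift c a ≤ gaussShift c (l * a) := by
  have h := (concaveOn_gaussShift hc).2 ha (left_mem_Icc.2 zero_le_one) hl.1
    (sub_nonneg.2 hl.2) (add_sub_cancel _ _)
  simpa [gaussShift_of_nonpos] using h

/-- Second order Taylor lower bound with cubic remainder. -/
lemma taylor_two_le {s : Set ℝ} (hs : Convex ℝ s) {f f' f'' : ℝ → ℝ} {A : ℝ}
    (hf : ∀ x ∈ s, HasDerivAt f (f' x) x) (hf' : ∀ x ∈ s, HasDerivAt f' (f'' x) x)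
    (hf'' : ∀ x ∈ s, ∀ y ∈ s, |f'' y - f'' x| ≤ A * |y - x|) (hA : 0 ≤ A) {a b : ℝ}
    (ha : a ∈ s) (hb : b ∈ s) :
    f a + f' a * (b - a) + f'' a / 2 * (b - a) ^ 2 - A * |b - a| ^ 3 ≤ f b := by
  have hsub : ∀ t, t ∈ uIcc a b → t ∈ s ∧ |t - a| ≤ |b - a| := fun t ht ↦
    ⟨hs.ordConnected.uIcc_subset ha hb ht, abs_sub_left_of_mem_uIcc ht⟩
  have h1 : ∀ t ∈ uIcc a b, |f' t - f' a - f'' a * (t - a)| ≤ A * |b - a| ^ 2 := by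
    intro t ht
    have := (convex_uIcc a b).norm_image_sub_le_of_norm_hasDerivWithin_le
      (f := fun t ↦ f' t - f'' a * t) (f' := fun t ↦ f'' t - f'' a * 1) (C := A * |b - a|)
      (fun t ht ↦ ((hf' t (hsub t ht).1).sub ((hasDerivAt_id t).const_mul _)).hasDerivWithinAt)
      (fun t ht ↦ by
        rw [mul_one, Real.norm_eq_abs]
        exact (hf'' a ha t (hsub t ht).1).trans (mul_le_mul_of_nonneg_left (hsub t ht).2 hA))
      left_mem_uIcc ht
    rw [Real.norm_eq_abs, Real.norm_eq_abs] at this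
    calc _ = |f' t - f'' a * t - (f' a - f'' a * a)| := by ring_nf
      _ ≤ _ := this
      _ ≤ A * |b - a| * |b - a| :=
        mul_le_mul_of_nonneg_left (hsub t ht).2 (by positivity)
      _ = _ := by ring
  have h2 := (convex_uIcc a b).norm_image_sub_le_of_norm_hasDerivWithin_le
      (f := fun t ↦ f t - f' a * t - f'' a / 2 * (t - a) ^ 2)
      (f' := fun t ↦ f' t - f' a * 1 - f'' a / 2 * (2 * (t - a) ^ 1 * 1)) (C := A * |b - a| ^ 2)
      (fun t ht ↦ (((hf t (hsub t ht).1).sub ((hasDerivAt_id t).const_mul _)).sub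
        ((((hasDerivAt_id t).sub_const a).pow 2).const_mul _)).hasDerivWithinAt)
      (fun t ht ↦ by
        rw [Real.norm_eq_abs]
        refine le_of_eq_of_le (congrArg _ ?_) (h1 t ht)
        ring)
      left_mem_uIcc right_mem_uIcc
  rw [Real.norm_eq_abs, Real.norm_eq_abs] at h2
  have h3 := (abs_le.1 h2).1
  simp only [sub_self] at h3
  nlinarith [h3]

/-- Uniform second order Taylor bound for `gaussShift c` away from `0` and `1`. -/
lemma exists_gaussShift_taylor (C M : ℝ) : ∃ A : ℝ, 0 ≤ A ∧ ∀ c ∈ Icc 0 C,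
    ∀ a ∈ Icc (gaussCDF (-M : ℝ)) (gaussCDF M), ∀ b ∈ Icc (gaussCDF (-M : ℝ)) (gaussCDF M),
    gaussShift c a + gaussShiftDeriv c a * (b - a) + gaussShiftDeriv₂ c a / 2 * (b - a) ^ 2
      - A * |b - a| ^ 3 ≤ gaussShift c b := by
  have hcont : Continuous fun p : ℝ × ℝ ↦
      -p.1 * (p.2 - p.1) * Real.exp (-p.1 * p.2 - p.1 ^ 2 / 2) * ((gaussPDF p.2)⁻¹) ^ 2 := by
    have : Continuous fun p : ℝ × ℝ ↦ (gaussPDF p.2)⁻¹ :=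
      (continuous_gaussPDF.comp continuous_snd).inv₀ fun p ↦ (gaussPDF_pos p.2).ne'
    fun_prop
  obtain ⟨A, hA⟩ := ((isCompact_Icc (a := (0 : ℝ)) (b := C)).prod
    (isCompact_Icc (a := -M) (b := M))).exists_bound_of_continuousOn hcont.continuousOn
  refine ⟨max A 0, le_max_right _ _, fun c hc a ha b hb ↦ ?_⟩
  have hsub : Icc (gaussCDF (-M : ℝ)) (gaussCDF M) ⊆ Ioo 0 1 := fun t ht ↦
    ⟨(gaussCDF_coe_pos _).trans_le ht.1, ht.2.trans_lt (gaussCDF_coe_lt_one _)⟩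
  refine taylor_two_le (convex_Icc (gaussCDF (-M : ℝ)) (gaussCDF M))
    (fun t ht ↦ hasDerivAt_gaussShift c (hsub ht))
    (fun t ht ↦ hasDerivAt_gaussShiftDeriv c (hsub ht)) (fun x hx y hy ↦ ?_) (le_max_right _ _) ha hb
  have := (convex_Icc (gaussCDF (-M : ℝ)) (gaussCDF M)).norm_image_sub_le_of_norm_hasDerivWithin_le
    (f := gaussShiftDeriv₂ c) (f' := fun t ↦ deriv (gaussShiftDeriv₂ c) t) (C := max A 0) ?_ ?_ hx hy
  · simpa only [Real.norm_eq_abs] using this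
  · intro t ht
    obtain ⟨w, rfl⟩ := exists_gaussCDF_eq (hsub ht).1 (hsub ht).2
    exact (hasDerivAt_gaussShiftDeriv₂ c w).differentiableAt.hasDerivAt.hasDerivWithinAt
  · intro t ht
    obtain ⟨w, rfl⟩ := exists_gaussCDF_eq (hsub ht).1 (hsub ht).2
    rw [(hasDerivAt_gaussShiftDeriv₂ c w).deriv]
    refine (hA (c, w) ⟨hc, ?_⟩).trans (le_max_left _ _)
    exact ⟨strictMono_gaussCDF_coe.le_iff_le.1 ht.1, strictMono_gaussCDF_coe.le_iff_le.1 ht.2⟩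

lemma gaussCDF_le_taylor (x y : ℝ) :
    gaussCDF y ≤ gaussCDF x + gaussPDF x * (y - x) + (y - x) ^ 2 := by
  have hlip : ∀ t, |gaussPDF t - gaussPDF x| ≤ |t - x| := fun t ↦ by
    have := (convex_univ (𝕜 := ℝ) (E := ℝ)).norm_image_sub_le_of_norm_hasDerivWithin_le (C := 1)
      (fun t _ ↦ (hasDerivAt_gaussPDF t).hasDerivWithinAt)
      (fun t _ ↦ by simpa [abs_mul] using abs_mul_gaussPDF_le_one t) (mem_univ x) (mem_univ t)
    simpa only [Real.norm_eq_abs, one_mul] using this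
  have h2 := (convex_uIcc x y).norm_image_sub_le_of_norm_hasDerivWithin_le
      (f := fun t : ℝ ↦ gaussCDF t - gaussPDF x * t)
      (f' := fun t ↦ gaussPDF t - gaussPDF x * 1) (C := |y - x|)
      (fun t ht ↦ ((hasDerivAt_gaussCDF t).sub ((hasDerivAt_id t).const_mul _)).hasDerivWithinAt)
      (fun t ht ↦ by
        rw [mul_one, Real.norm_eq_abs]
        exact (hlip t).trans (abs_sub_left_of_mem_uIcc ht))
      left_mem_uIcc right_mem_uIcc
  rw [Real.norm_eq_abs, Real.norm_eq_abs, abs_mul_abs_self] at h2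
  have h3 := (abs_le.1 h2).2
  nlinarith [h3]

/-! ### The standard Gaussian measure on a Euclidean space -/

section StdGaussian

variable {E : Type*} [NormedAddCommGroup E] [InnerProductSpace ℝ E] [FiniteDimensional ℝ E]
  [MeasurableSpace E] [BorelSpace E]

lemma map_inner_stdGaussian (u : E) :
    (stdGaussian E).map (fun y ↦ ⟪u, y⟫) = gaussianReal 0 (‖u‖₊ ^ 2) := by
  have h := IsGaussian.map_eq_gaussianReal (μ := stdGaussian E) (innerSL ℝ u)
  rw [integral_strongDual_stdGaussian, variance_dual_stdGaussian, innerSL_apply_norm] at h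
  rw [show ‖u‖₊ ^ 2 = (‖u‖ ^ 2).toNNReal by
    rw [Real.toNNReal_pow (norm_nonneg u), norm_toNNReal]]
  exact h

lemma mgf_inner_stdGaussian (u : E) (t : ℝ) :
    ∫ y, Real.exp (t * ⟪u, y⟫) ∂stdGaussian E = Real.exp (‖u‖ ^ 2 * t ^ 2 / 2) := by
  have h := mgf_gaussianReal (map_inner_stdGaussian u) t
  simpa [mgf] using h

lemma integrable_exp_inner_stdGaussian (u : E) (t : ℝ) :
    Integrable (fun y ↦ Real.exp (t * ⟪u, y⟫)) (stdGaussian E) := by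
  have h := integrable_exp_mul_gaussianReal (μ := 0) (v := ‖u‖₊ ^ 2) t
  rw [← map_inner_stdGaussian u] at h
  exact h.comp_measurable (by fun_prop)

lemma integral_inner_sq_stdGaussian (u : E) :
    ∫ y, ⟪u, y⟫ ^ 2 ∂stdGaussian E = ‖u‖ ^ 2 := by
  have h := variance_dual_stdGaussian (innerSL ℝ u)
  rw [variance_of_integral_eq_zero (by fun_prop) (integral_strongDual_stdGaussian _)] at h
  simpa using h

lemma integral_inner_stdGaussian (u : E) : ∫ y, ⟪u, y⟫ ∂stdGaussian E = 0 := by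
  simpa using integral_strongDual_stdGaussian (innerSL ℝ u)

lemma integrable_norm_pow_stdGaussian (k : ℕ) :
    Integrable (fun y : E ↦ ‖y‖ ^ k) (stdGaussian E) := by
  simpa using (IsGaussian.memLp_id (stdGaussian E) k (by simp)).integrable_norm_pow'

lemma integrable_inner_stdGaussian (u : E) : Integrable (fun y ↦ ⟪u, y⟫) (stdGaussian E) := by
  simpa using IsGaussian.integrable_dual (stdGaussian E) (innerSL ℝ u)

lemma integrable_inner_sq_stdGaussian (u : E) :
    Integrable (fun y ↦ ⟪u, y⟫ ^ 2) (stdGaussian E) := by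
  refine ((integrable_norm_pow_stdGaussian (E := E) 2).const_mul (‖u‖ ^ 2)).mono' (by fun_prop) ?_
  filter_upwards with y
  rw [norm_pow, ← mul_pow]
  exact pow_le_pow_left₀ (norm_nonneg _) (norm_inner_le_norm u y) 2

lemma integral_cexp_stdGaussian (u s : E) :
    ∫ y, Complex.exp ((⟪u, y⟫ : ℂ) + ⟪y, s⟫ * Complex.I) ∂stdGaussian E
      = Complex.exp ((‖u‖ ^ 2 - ‖s‖ ^ 2) / 2 + ⟪u, s⟫ * Complex.I) := by
  rw [stdGaussian, integral_map (Measurable.aemeasurable (by fun_prop))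
    (Measurable.aestronglyMeasurable (by fun_prop))]
  set b := stdOrthonormalBasis ℝ E
  have h1 : ∀ x : Fin (Module.finrank ℝ E) → ℝ,
      Complex.exp (((⟪u, ∑ i, x i • b i⟫ : ℝ) : ℂ) + (⟪∑ i, x i • b i, s⟫ : ℝ) * Complex.I)
      = ∏ i, Complex.exp (((⟪u, b i⟫ : ℝ) + (⟪b i, s⟫ : ℝ) * Complex.I) * x i) := by
    intro x
    rw [← Complex.exp_sum, inner_sum, sum_inner]
    simp only [inner_smul_left, inner_smul_right, Complex.ofReal_sum, Finset.sum_mul,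
      ← Finset.sum_add_distrib]
    congr 1
    refine Finset.sum_congr rfl fun i _ ↦ ?_
    simp
    ring
  simp_rw [h1]
  rw [integral_fintype_prod_eq_prod
    (f := fun i (x : ℝ) ↦ Complex.exp (((⟪u, b i⟫ : ℝ) + (⟪b i, s⟫ : ℝ) * Complex.I) * x))]
  have h2 : ∀ z : ℂ, ∫ x : ℝ, Complex.exp (z * x) ∂gaussianReal 0 1 = Complex.exp (z ^ 2 / 2) := by
    intro z
    simpa [complexMGF] using complexMGF_id_gaussianReal (μ := 0) (v := 1) z
  simp_rw [h2]
  rw [← Complex.exp_sum]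
  congr 1
  have hu := b.sum_sq_inner_left u
  have hs := b.sum_sq_inner_right s
  have hus := b.sum_inner_mul_inner u s
  rw [← Complex.ofReal_pow, ← Complex.ofReal_pow, ← hu, ← hs, ← hus]
  push_cast
  rw [← Finset.sum_sub_distrib, Finset.sum_div, Finset.sum_mul, ← Finset.sum_add_distrib]
  refine Finset.sum_congr rfl fun i _ ↦ ?_
  ring_nf
  rw [Complex.I_sq]
  ring

/-- The Cameron-Martin formula for the standard Gaussian measure. -/
lemma map_add_right_stdGaussian (u : E) :
    (stdGaussian E).map (· + u) = (stdGaussian E).tilted (fun y ↦ ⟪u, y⟫) := by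
  have hint : Integrable (fun y ↦ Real.exp ⟪u, y⟫) (stdGaussian E) := by
    simpa using integrable_exp_inner_stdGaussian u 1
  have hZ : ∫ y, Real.exp ⟪u, y⟫ ∂stdGaussian E = Real.exp (‖u‖ ^ 2 / 2) := by
    simpa using mgf_inner_stdGaussian u 1
  have := isProbabilityMeasure_tilted hint
  have : IsProbabilityMeasure ((stdGaussian E).map (· + u)) :=
    Measure.isProbabilityMeasure_map (by fun_prop)
  refine Measure.ext_of_charFun (funext fun s ↦ ?_)
  rw [charFun_map_add_const, charFun_stdGaussian, charFun_apply, integral_tilted, hZ]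
  have h1 : ∀ y : E, (Real.exp ⟪u, y⟫ / Real.exp (‖u‖ ^ 2 / 2)) • Complex.exp (⟪y, s⟫ * Complex.I)
      = Complex.exp (-(‖u‖ ^ 2 / 2)) * Complex.exp ((⟪u, y⟫ : ℂ) + ⟪y, s⟫ * Complex.I) := by
    intro y
    rw [← Real.exp_sub, Complex.real_smul, Complex.ofReal_exp, ← Complex.exp_add,
      ← Complex.exp_add]
    congr 1
    push_cast; ring
  simp_rw [h1]
  rw [integral_const_mul, integral_cexp_stdGaussian, ← Complex.exp_add, ← Complex.exp_add]
  congr 1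
  ring

lemma integral_add_stdGaussian {F : E → ℝ} (hF : Measurable F) (u : E) :
    ∫ y, F (y + u) ∂stdGaussian E
      = ∫ y, Real.exp (⟪u, y⟫ - ‖u‖ ^ 2 / 2) * F y ∂stdGaussian E := by
  have h := integral_map (μ := stdGaussian E) (φ := (· + u)) (f := F) (by fun_prop)
    hF.aestronglyMeasurable
  have hZ : ∫ y, Real.exp ⟪u, y⟫ ∂stdGaussian E = Real.exp (‖u‖ ^ 2 / 2) := by
    simpa using mgf_inner_stdGaussian u 1
  rw [← h, map_add_right_stdGaussian, integral_tilted, hZ]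
  simp_rw [Real.exp_sub, smul_eq_mul]

lemma conv_stdGaussian (a b : ℝ) :
    ((stdGaussian E).map (a • ·)).conv ((stdGaussian E).map (b • ·))
      = (stdGaussian E).map (√(a ^ 2 + b ^ 2) • ·) := by
  have h : ∀ r : ℝ, IsProbabilityMeasure ((stdGaussian E).map (r • ·)) := fun r ↦
    Measure.isProbabilityMeasure_map (by fun_prop)
  have := h a
  have := h b
  have := h √(a ^ 2 + b ^ 2)
  refine Measure.ext_of_charFun (funext fun s ↦ ?_)
  simp_rw [charFun_conv, charFun_map_smul, charFun_stdGaussian, norm_smul, ← Complex.exp_add]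
  congr 1
  rw [← Complex.ofReal_pow, ← Complex.ofReal_pow, ← Complex.ofReal_pow, mul_pow, mul_pow, mul_pow]
  simp only [Real.norm_eq_abs, sq_abs, Real.sq_sqrt (add_nonneg (sq_nonneg a) (sq_nonneg b))]
  push_cast; ring

/-- Gaussian smoothing at scale `σ`. -/
def gaussSmooth (σ : ℝ) (f : E → ℝ) (x : E) : ℝ := ∫ y, f (x + σ • y) ∂stdGaussian E

lemma measurable_gaussSmooth (σ : ℝ) {f : E → ℝ} (hf : Measurable f) :
    Measurable (gaussSmooth σ f) := by
  have : StronglyMeasurable (Function.uncurry fun x y : E ↦ f (x + σ • y)) :=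
    Measurable.stronglyMeasurable (by simp only [Function.uncurry_def]; fun_prop)
  exact this.integral_prod_right.measurable

lemma integrable_of_mem_Icc {α : Type*} [MeasurableSpace α] {μ : Measure α} [IsFiniteMeasure μ]
    {f : α → ℝ} (hf : Measurable f) {a b : ℝ} (h : ∀ x, f x ∈ Icc a b) : Integrable f μ :=
  Integrable.of_mem_Icc a b hf.aemeasurable (ae_of_all _ h)

lemma integral_mem_Icc_of_forall {α : Type*} [MeasurableSpace α] {μ : Measure α}
    [IsProbabilityMeasure μ] {f : α → ℝ} (hf : Measurable f) {a b : ℝ} (h : ∀ x, f x ∈ Icc a b) :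
    ∫ x, f x ∂μ ∈ Icc a b := by
  have hi := integrable_of_mem_Icc (μ := μ) hf h
  constructor
  · simpa using integral_mono (integrable_const a) hi fun x ↦ (h x).1
  · simpa using integral_mono hi (integrable_const b) fun x ↦ (h x).2

lemma gaussSmooth_mem_Icc (σ : ℝ) {f : E → ℝ} (hf : Measurable f) {a b : ℝ}
    (h : ∀ x, f x ∈ Icc a b) (x : E) : gaussSmooth σ f x ∈ Icc a b :=
  integral_mem_Icc_of_forall (by fun_prop) fun _ ↦ h _

lemma gaussSmooth_gaussSmooth (σ τ : ℝ) {f : E → ℝ} (hf : Measurable f) {a b : ℝ}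
    (h : ∀ x, f x ∈ Icc a b) (x : E) :
    gaussSmooth σ (gaussSmooth τ f) x = gaussSmooth √(σ ^ 2 + τ ^ 2) f x := by
  have hp : ∀ r : ℝ, IsProbabilityMeasure ((stdGaussian E).map (r • ·)) := fun r ↦
    Measure.isProbabilityMeasure_map (by fun_prop)
  have := hp σ
  have := hp τ
  have h1 := integral_conv (μ := (stdGaussian E).map (σ • ·)) (ν := (stdGaussian E).map (τ • ·))
    (f := fun z ↦ f (x + z)) (integrable_of_mem_Icc (by fun_prop) fun _ ↦ h _)
  rw [conv_stdGaussian, integral_map (by fun_prop)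
    (Measurable.aestronglyMeasurable (by fun_prop))] at h1
  rw [gaussSmooth, gaussSmooth, h1, integral_map (by fun_prop)]
  · refine integral_congr_ae (ae_of_all _ fun y ↦ ?_)
    simp only [gaussSmooth]
    rw [integral_map (by fun_prop) (Measurable.aestronglyMeasurable (by fun_prop))]
    simp_rw [add_assoc]
  · refine Measurable.aestronglyMeasurable ?_
    have : StronglyMeasurable (Function.uncurry fun z y : E ↦ f (x + (z + y))) :=
      Measurable.stronglyMeasurable (by simp only [Function.uncurry_def]; fun_prop)
    exact this.integral_prod_right.measurable

end StdGaussian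

lemma gaussSmooth_mul {E : Type*} [NormedAddCommGroup E] [InnerProductSpace ℝ E]
    [FiniteDimensional ℝ E] [MeasurableSpace E] (σ τ : ℝ) (f : E → ℝ) (x z : E) :
    gaussSmooth τ (fun y ↦ f (x + σ • y)) z = gaussSmooth (σ * τ) f (x + σ • z) := by
  simp only [gaussSmooth, smul_add, smul_smul, add_assoc]

section FirstOrder

variable {E : Type*} [NormedAddCommGroup E] [InnerProductSpace ℝ E] [FiniteDimensional ℝ E]
  [MeasurableSpace E] [BorelSpace E]

lemma integral_exp_sub_sq (u : E) :
    ∫ y, (Real.exp (⟪u, y⟫ - ‖u‖ ^ 2 / 2) - 1 - ⟪u, y⟫) ^ 2 ∂stdGaussian E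
      = Real.exp (‖u‖ ^ 2) - 1 - ‖u‖ ^ 2 ∧
    Integrable (fun y ↦ (Real.exp (⟪u, y⟫ - ‖u‖ ^ 2 / 2) - 1 - ⟪u, y⟫) ^ 2) (stdGaussian E) := by
  have e2 : ∀ y : E, Real.exp (⟪u, y⟫ - ‖u‖ ^ 2 / 2) ^ 2
      = Real.exp (-‖u‖ ^ 2) * Real.exp (2 * ⟪u, y⟫) := fun y ↦ by
    rw [← Real.exp_nat_mul, ← Real.exp_add]; congr 1; push_cast; ring
  have e1 : ∀ y : E, Real.exp (⟪u, y⟫ - ‖u‖ ^ 2 / 2)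
      = Real.exp (-(‖u‖ ^ 2 / 2)) * Real.exp (1 * ⟪u, y⟫) := fun y ↦ by
    rw [← Real.exp_add]; congr 1; ring
  have hI1 : Integrable (fun y ↦ Real.exp (⟪u, y⟫ - ‖u‖ ^ 2 / 2)) (stdGaussian E) := by
    simp_rw [e1]; exact (integrable_exp_inner_stdGaussian u 1).const_mul _
  have hI2 : Integrable (fun y ↦ Real.exp (⟪u, y⟫ - ‖u‖ ^ 2 / 2) ^ 2) (stdGaussian E) := by
    simp_rw [e2]; exact (integrable_exp_inner_stdGaussian u 2).const_mul _
  have hN1 := integrable_inner_stdGaussian u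
  have hN2 := integrable_inner_sq_stdGaussian u
  have hX : Integrable (fun y ↦ Real.exp (⟪u, y⟫ - ‖u‖ ^ 2 / 2) * ⟪u, y⟫) (stdGaussian E) := by
    refine (hI2.add hN2).mono' (by fun_prop) (ae_of_all _ fun y ↦ ?_)
    rw [Real.norm_eq_abs, Pi.add_apply, abs_le]
    constructor <;> nlinarith [sq_nonneg (Real.exp (⟪u, y⟫ - ‖u‖ ^ 2 / 2) - ⟪u, y⟫),
      sq_nonneg (Real.exp (⟪u, y⟫ - ‖u‖ ^ 2 / 2) + ⟪u, y⟫),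
      sq_nonneg (Real.exp (⟪u, y⟫ - ‖u‖ ^ 2 / 2)), sq_nonneg ⟪u, y⟫]
  have v1 : ∫ y, Real.exp (⟪u, y⟫ - ‖u‖ ^ 2 / 2) ∂stdGaussian E = 1 := by
    simp_rw [e1]
    rw [integral_const_mul, mgf_inner_stdGaussian, ← Real.exp_add, Real.exp_eq_one_iff]
    ring
  have v2 : ∫ y, Real.exp (⟪u, y⟫ - ‖u‖ ^ 2 / 2) ^ 2 ∂stdGaussian E = Real.exp (‖u‖ ^ 2) := by
    simp_rw [e2]
    rw [integral_const_mul, mgf_inner_stdGaussian, ← Real.exp_add]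
    congr 1; ring
  have vX : ∫ y, Real.exp (⟪u, y⟫ - ‖u‖ ^ 2 / 2) * ⟪u, y⟫ ∂stdGaussian E = ‖u‖ ^ 2 := by
    rw [← integral_add_stdGaussian (F := fun y ↦ ⟪u, y⟫) (by fun_prop)]
    simp_rw [inner_add_right, real_inner_self_eq_norm_sq]
    rw [integral_add hN1 (integrable_const _), integral_inner_stdGaussian]
    simp
  have hexp : (fun y : E ↦ (Real.exp (⟪u, y⟫ - ‖u‖ ^ 2 / 2) - 1 - ⟪u, y⟫) ^ 2)
      = fun y ↦ (Real.exp (⟪u, y⟫ - ‖u‖ ^ 2 / 2) ^ 2 + 1 + ⟪u, y⟫ ^ 2)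
        + (2 * ⟪u, y⟫ - 2 * Real.exp (⟪u, y⟫ - ‖u‖ ^ 2 / 2)
          - 2 * (Real.exp (⟪u, y⟫ - ‖u‖ ^ 2 / 2) * ⟪u, y⟫)) := by
    funext y; ring
  rw [hexp]
  have hA : Integrable (fun y : E ↦ Real.exp (⟪u, y⟫ - ‖u‖ ^ 2 / 2) ^ 2 + 1) (stdGaussian E) :=
    hI2.add (integrable_const 1)
  have hB : Integrable (fun y : E ↦ 2 * ⟪u, y⟫ - 2 * Real.exp (⟪u, y⟫ - ‖u‖ ^ 2 / 2))
    (stdGaussian E) := (hN1.const_mul 2).sub (hI1.const_mul 2)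
  have hA' : Integrable (fun y : E ↦ Real.exp (⟪u, y⟫ - ‖u‖ ^ 2 / 2) ^ 2 + 1 + ⟪u, y⟫ ^ 2)
    (stdGaussian E) := hA.add hN2
  have hB' : Integrable (fun y : E ↦ 2 * ⟪u, y⟫ - 2 * Real.exp (⟪u, y⟫ - ‖u‖ ^ 2 / 2)
    - 2 * (Real.exp (⟪u, y⟫ - ‖u‖ ^ 2 / 2) * ⟪u, y⟫)) (stdGaussian E) := hB.sub (hX.const_mul 2)
  refine ⟨?_, hA'.add hB'⟩
  rw [integral_add hA' hB', integral_add hA hN2,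
    integral_add hI2 (integrable_const 1), integral_sub hB (hX.const_mul 2),
    integral_sub (hN1.const_mul 2) (hI1.const_mul 2), integral_const_mul, integral_const_mul,
    integral_const_mul, v1, v2, vX, integral_inner_stdGaussian, integral_inner_sq_stdGaussian]
  simp
  ring

lemma integrable_mul_of_mem_Icc {α : Type*} [MeasurableSpace α] {μ : Measure α}
    {f g : α → ℝ} (hf : Measurable f) (h : ∀ x, f x ∈ Icc 0 1) (hg : Integrable g μ) :
    Integrable (fun x ↦ f x * g x) μ :=
  hg.bdd_mul hf.aestronglyMeasurable (c := 1) (ae_of_all _ fun x ↦ by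
    rw [Real.norm_eq_abs, abs_of_nonneg (h x).1]; exact (h x).2)

/-- The barycentre `∫ f(y) y dν(y)`. -/
def gaussMoment (f : E → ℝ) : E := ∫ y, f y • y ∂stdGaussian E

lemma inner_gaussMoment {f : E → ℝ} (hf : Measurable f) (h : ∀ x, f x ∈ Icc 0 1) (u : E) :
    ⟪u, gaussMoment f⟫ = ∫ y, f y * ⟪u, y⟫ ∂stdGaussian E := by
  rw [gaussMoment, ← integral_inner]
  · simp_rw [inner_smul_right]
  · have h1 : Integrable (fun y : E ↦ y) (stdGaussian E) := IsGaussian.integrable_id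
    exact h1.bdd_smul 1 hf.aestronglyMeasurable (ae_of_all _ fun x ↦ by
      rw [Real.norm_eq_abs, abs_of_nonneg (h x).1]; exact (h x).2)

/-- First order expansion of a Gaussian convolution, with an explicit quadratic remainder. -/
lemma abs_integral_add_sub_le {f : E → ℝ} (hf : Measurable f) (h : ∀ x, f x ∈ Icc 0 1) (u : E) :
    |∫ y, f (y + u) ∂stdGaussian E - ∫ y, f y ∂stdGaussian E - ⟪u, gaussMoment f⟫|
      ≤ 3 * ‖u‖ ^ 2 := by
  have habs : ∀ y, |f y| ≤ 1 := fun y ↦ by rw [abs_of_nonneg (h y).1]; exact (h y).2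
  rcases le_or_gt 1 ‖u‖ with hu | hu
  · have h1 := integral_mem_Icc_of_forall (μ := stdGaussian E) (f := fun y ↦ f (y + u))
      (by fun_prop) fun y ↦ h _
    have h2 := integral_mem_Icc_of_forall (μ := stdGaussian E) hf h
    have h3 : |⟪u, gaussMoment f⟫| ≤ (1 + ‖u‖ ^ 2) / 2 := by
      rw [inner_gaussMoment hf h]
      have h4 : ∫ y, (1 + ⟪u, y⟫ ^ 2) / 2 ∂stdGaussian E = (1 + ‖u‖ ^ 2) / 2 := by
        rw [integral_div, integral_add (integrable_const _) (integrable_inner_sq_stdGaussian u),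
          integral_inner_sq_stdGaussian]
        simp
      rw [← h4]
      have h5 : Integrable (fun y ↦ (1 + ⟪u, y⟫ ^ 2) / 2) (stdGaussian E) :=
        ((integrable_const (1 : ℝ)).add (integrable_inner_sq_stdGaussian u)).div_const 2
      rw [← Real.norm_eq_abs]
      refine norm_integral_le_of_norm_le h5 (ae_of_all _ fun y ↦ ?_)
      rw [norm_mul, Real.norm_eq_abs, Real.norm_eq_abs]
      nlinarith [habs y, abs_nonneg ⟪u, y⟫, sq_abs ⟪u, y⟫, sq_nonneg (|⟪u, y⟫| - 1)]
    have h3' := abs_le.1 h3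
    rw [abs_le]
    constructor <;> nlinarith [h1.1, h1.2, h2.1, h2.2]
  · rcases eq_or_ne u 0 with rfl | hu0
    · simp
    have hupos : 0 < ‖u‖ := norm_pos_iff.2 hu0
    obtain ⟨hval, hint⟩ := integral_exp_sub_sq u
    have hfi : Integrable f (stdGaussian E) := integrable_of_mem_Icc hf h
    have hI1 : Integrable (fun y ↦ Real.exp (⟪u, y⟫ - ‖u‖ ^ 2 / 2)) (stdGaussian E) := by
      have := (integrable_exp_inner_stdGaussian u 1).mul_const (Real.exp (‖u‖ ^ 2 / 2))⁻¹
      simpa [Real.exp_sub, div_eq_mul_inv] using this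
    have hN1 := integrable_inner_stdGaussian u
    have heq : ∫ y, f (y + u) ∂stdGaussian E - ∫ y, f y ∂stdGaussian E - ⟪u, gaussMoment f⟫
        = ∫ y, f y * (Real.exp (⟪u, y⟫ - ‖u‖ ^ 2 / 2) - 1 - ⟪u, y⟫) ∂stdGaussian E := by
      rw [integral_add_stdGaussian hf, inner_gaussMoment hf h, ← integral_sub _ hfi,
        ← integral_sub _ (integrable_mul_of_mem_Icc hf h hN1)]
      · congr 1; funext y; ring
      · simp_rw [mul_comm _ (f _)]
        exact (integrable_mul_of_mem_Icc hf h hI1).sub hfi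
      · simp_rw [mul_comm _ (f _)]
        exact integrable_mul_of_mem_Icc hf h hI1
    rw [heq]
    have hbound : ∫ y, ((Real.exp (⟪u, y⟫ - ‖u‖ ^ 2 / 2) - 1 - ⟪u, y⟫) ^ 2 / ‖u‖ ^ 2 + ‖u‖ ^ 2)
        ∂stdGaussian E ≤ 3 * ‖u‖ ^ 2 := by
      rw [integral_add (hint.div_const _) (integrable_const _), integral_div, hval]
      have hx : ‖u‖ ^ 2 ≤ 1 := by nlinarith
      have := Real.abs_exp_sub_one_sub_id_le (x := ‖u‖ ^ 2) (by rwa [abs_of_nonneg (sq_nonneg _)])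
      have h5 := le_of_abs_le this
      have h6 : (Real.exp (‖u‖ ^ 2) - 1 - ‖u‖ ^ 2) / ‖u‖ ^ 2 ≤ ‖u‖ ^ 2 := by
        rw [div_le_iff₀ (by positivity)]; nlinarith
      simp only [integral_const, probReal_univ, smul_eq_mul, one_mul]
      nlinarith [sq_nonneg ‖u‖]
    refine le_trans ?_ hbound
    have h9 : Integrable (fun y ↦ (Real.exp (⟪u, y⟫ - ‖u‖ ^ 2 / 2) - 1 - ⟪u, y⟫) ^ 2 / ‖u‖ ^ 2
      + ‖u‖ ^ 2) (stdGaussian E) := (hint.div_const _).add (integrable_const _)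
    rw [← Real.norm_eq_abs]
    refine norm_integral_le_of_norm_le h9 (ae_of_all _ fun y ↦ ?_)
    set g := Real.exp (⟪u, y⟫ - ‖u‖ ^ 2 / 2) - 1 - ⟪u, y⟫
    rw [norm_mul, Real.norm_eq_abs, Real.norm_eq_abs]
    have h7 : |g| ≤ g ^ 2 / ‖u‖ ^ 2 + ‖u‖ ^ 2 := by
      have : g ^ 2 / ‖u‖ ^ 2 = (|g| / ‖u‖) ^ 2 := by rw [div_pow, sq_abs]
      rw [this]
      have h8 : |g| = (|g| / ‖u‖) * ‖u‖ := by field_simp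
      nlinarith [sq_nonneg (|g| / ‖u‖ - ‖u‖), sq_nonneg (|g| / ‖u‖), sq_nonneg ‖u‖]
    calc |f y| * |g| ≤ 1 * |g| := by gcongr; exact habs y
      _ ≤ _ := by rwa [one_mul]

lemma integral_Iic_mul_gaussPDF (w : ℝ) : ∫ u in Iic w, -u * gaussPDF u = gaussPDF w := by
  have hlim : Tendsto gaussPDF atBot (𝓝 0) := by
    rw [show gaussPDF = _ from funext gaussPDF_eq, ← mul_zero (√(2 * Real.pi))⁻¹]
    refine Tendsto.const_mul _ (Real.tendsto_exp_atBot.comp ?_)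
    have h2 : Tendsto (fun x : ℝ ↦ x ^ 2) atBot atTop := by
      simpa [Function.comp_def] using (tendsto_pow_atTop (α := ℝ) two_ne_zero).comp (tendsto_neg_atBot_atTop (G := ℝ))
    have h3 : Tendsto (fun x : ℝ ↦ -x ^ 2) atBot atBot := tendsto_neg_atTop_atBot.comp h2
    exact h3.atBot_div_const two_pos
  have hint : IntegrableOn (fun u ↦ -u * gaussPDF u) (Iic w) := by
    refine Integrable.integrableOn ?_
    have h1 := (integrable_mul_exp_neg_mul_sq (b := 1 / 2) (by norm_num)).const_mul
      (-(√(2 * Real.pi))⁻¹)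
    refine h1.congr (ae_of_all _ fun u ↦ ?_)
    simp only [gaussPDF_eq]
    ring_nf
  have := integral_Iic_of_hasDerivAt_of_tendsto' (fun x _ ↦ hasDerivAt_gaussPDF x) hint hlim
  simpa using this

/-- The bathtub principle: among functions `E → [0, 1]` of given Gaussian mean, indicators of
half-spaces have the largest barycentre. -/
lemma norm_gaussMoment_le {f : E → ℝ} (hf : Measurable f) (h : ∀ x, f x ∈ Icc 0 1) {w : ℝ}
    (hw : ∫ y, f y ∂stdGaussian E = gaussCDF w) : ‖gaussMoment f‖ ≤ gaussPDF w := by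
  set m := gaussMoment f with hm
  rcases eq_or_ne m 0 with h0 | h0
  · rw [h0, norm_zero]; exact (gaussPDF_pos w).le
  set e : E := -(‖m‖⁻¹ • m) with he
  have hnorm : ‖e‖ = 1 := by
    rw [he, norm_neg, norm_smul, norm_inv, norm_norm, inv_mul_cancel₀ (norm_ne_zero_iff.2 h0)]
  have hem : ⟪e, m⟫ = -‖m‖ := by
    rw [he, inner_neg_left, real_inner_smul_left, real_inner_self_eq_norm_sq]
    field_simp
  have hmap : (stdGaussian E).map (fun y ↦ ⟪e, y⟫) = gaussianReal 0 1 := by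
    have : ‖e‖₊ = 1 := NNReal.eq hnorm
    rw [map_inner_stdGaussian, this, one_pow]
  rw [inner_gaussMoment hf h] at hem
  have hN := integrable_inner_stdGaussian e
  have hfi : Integrable f (stdGaussian E) := integrable_of_mem_Icc hf h
  let g : ℝ → ℝ := (Iic w).indicator fun u ↦ w - u
  have hg : Measurable g := Measurable.indicator (by fun_prop) measurableSet_Iic
  have hid : Integrable (fun u : ℝ ↦ u) (gaussianReal 0 1) := IsGaussian.integrable_id
  have hgi : Integrable g (gaussianReal 0 1) :=
    ((integrable_const w).sub hid).indicator measurableSet_Iic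
  have hgv : ∫ u, g u ∂gaussianReal 0 1 = w * gaussCDF w + gaussPDF w := by
    rw [integral_indicator measurableSet_Iic, integral_sub (integrable_const w).integrableOn
      hid.integrableOn, setIntegral_const, ← gaussCDF_coe, smul_eq_mul, mul_comm w,
      ← integral_Iic_mul_gaussPDF w]
    rw [← integral_indicator measurableSet_Iic,
      integral_gaussianReal_eq_integral_smul one_ne_zero, ← integral_indicator measurableSet_Iic,
      sub_eq_add_neg, ← integral_neg]
    congr 2
    funext u
    by_cases hu : u ∈ Iic w
    · simp [hu, mul_comm]
    · simp [hu]
  have hle : ∫ y, f y * (w - ⟪e, y⟫) ∂stdGaussian E ≤ ∫ y, g ⟪e, y⟫ ∂stdGaussian E := by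
    refine integral_mono (integrable_mul_of_mem_Icc hf h ((integrable_const w).sub hN)) ?_ ?_
    · rw [← hmap] at hgi
      exact hgi.comp_measurable (by fun_prop)
    · intro y
      by_cases hy : ⟪e, y⟫ ∈ Iic w
      · simp only [g, indicator_of_mem hy]
        have := sub_nonneg.2 (mem_Iic.1 hy)
        nlinarith [(h y).2]
      · simp only [g, indicator_of_notMem hy]
        have := not_le.1 (fun hc ↦ hy (mem_Iic.2 hc))
        nlinarith [(h y).1]
  rw [← integral_map (φ := fun y ↦ ⟪e, y⟫) (by fun_prop) hg.aestronglyMeasurable, hmap, hgv] at hle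
  simp_rw [mul_sub] at hle
  rw [integral_sub (hfi.mul_const w) (integrable_mul_of_mem_Icc hf h hN), integral_mul_const,
    hw, hem] at hle
  linarith

end FirstOrder

/-! ### One step of the semigroup interpolation -/

lemma abs_gaussPDF_sub_le {M w w' : ℝ} (hw : w ∈ Icc (-M) M) (hw' : w' ∈ Icc (-M) M) :
    |gaussPDF w' - gaussPDF w| ≤ M * |gaussCDF w' - gaussCDF w| := by
  have key : ∀ u ∈ Icc (-M) M, ∀ v ∈ Icc (-M) M, u ≤ v →
      |gaussPDF v - gaussPDF u| ≤ M * (gaussCDF v - gaussCDF u) := by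
    intro u hu v hv huv
    have h1 : MonotoneOn (fun x : ℝ ↦ M * gaussCDF x - gaussPDF x) (Icc (-M) M) := by
      refine monotoneOn_of_hasDerivWithinAt_nonneg (convex_Icc _ _)
        (f' := fun x ↦ M * gaussPDF x - -x * gaussPDF x) ?_ ?_ ?_
      · exact ((continuous_gaussCDF_coe.const_mul M).sub continuous_gaussPDF).continuousOn
      · exact fun x _ ↦ (((hasDerivAt_gaussCDF x).const_mul M).sub
          (hasDerivAt_gaussPDF x)).hasDerivWithinAt
      · intro x hx
        have := interior_subset hx
        nlinarith [gaussPDF_pos x, this.1]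
    have h2 : MonotoneOn (fun x : ℝ ↦ M * gaussCDF x + gaussPDF x) (Icc (-M) M) := by
      refine monotoneOn_of_hasDerivWithinAt_nonneg (convex_Icc _ _)
        (f' := fun x ↦ M * gaussPDF x + -x * gaussPDF x) ?_ ?_ ?_
      · exact ((continuous_gaussCDF_coe.const_mul M).add continuous_gaussPDF).continuousOn
      · exact fun x _ ↦ (((hasDerivAt_gaussCDF x).const_mul M).add
          (hasDerivAt_gaussPDF x)).hasDerivWithinAt
      · intro x hx
        have := interior_subset hx
        nlinarith [gaussPDF_pos x, this.2]
    have h3 := h1 hu hv huv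
    have h4 := h2 hu hv huv
    simp only at h3 h4
    rw [abs_le]
    constructor <;> linarith
  rcases le_total w w' with h | h
  · rw [abs_of_nonneg (sub_nonneg.2 (strictMono_gaussCDF_coe.monotone h))]
    exact key w hw w' hw' h
  · rw [abs_sub_comm, abs_sub_comm (gaussCDF w'),
      abs_of_nonneg (sub_nonneg.2 (strictMono_gaussCDF_coe.monotone h))]
    exact key w' hw' w hw h

lemma one_div_sqrt_one_add_sq_bounds {h : ℝ} (h0 : 0 ≤ h) (h1 : h ≤ 1) :
    1 - h ^ 2 ≤ 1 / √(1 + h ^ 2) ∧ 1 / √(1 + h ^ 2) ≤ 1 - h ^ 2 / 2 + h ^ 4 := by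
  set s := √(1 + h ^ 2) with hs
  have hs2 : s ^ 2 = 1 + h ^ 2 := Real.sq_sqrt (by positivity)
  have hspos : 0 < s := Real.sqrt_pos.2 (by positivity)
  have ht : h ^ 2 ≤ 1 := by nlinarith
  have ht0 := sq_nonneg h
  constructor
  · rw [le_div_iff₀ hspos]
    refine (sq_le_sq₀ (mul_nonneg (sub_nonneg.2 ht) hspos.le) zero_le_one).1 ?_
    rw [mul_pow, hs2]
    generalize h ^ 2 = t at ht ht0
    nlinarith [mul_nonneg ht0 (sub_nonneg.2 ht), mul_nonneg (mul_nonneg ht0 ht0) (sub_nonneg.2 ht)]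
  · have e : h ^ 4 = (h ^ 2) ^ 2 := by ring
    rw [div_le_iff₀ hspos, e]
    generalize h ^ 2 = t at hs2 ht ht0
    refine (sq_le_sq₀ zero_le_one (mul_nonneg (by nlinarith [sq_nonneg t]) hspos.le)).1 ?_
    rw [mul_pow, hs2]
    have : (1 - t / 2 + t ^ 2) ^ 2 * (1 + t) = 1 + 5 / 4 * t ^ 2 + 5 / 4 * t ^ 3 + t ^ 5 := by ring
    rw [this]
    have : 0 ≤ 5 / 4 * t ^ 2 + 5 / 4 * t ^ 3 + t ^ 5 := by positivity
    linarith

section Step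

variable {E : Type*} [NormedAddCommGroup E] [InnerProductSpace ℝ E] [FiniteDimensional ℝ E]
  [MeasurableSpace E] [BorelSpace E]

/-- Uniform moment estimates for the fluctuation of a Gaussian smoothing under a small further
smoothing of size `h`. -/
lemma exists_gaussSmooth_moment_bounds (E : Type*) [NormedAddCommGroup E] [InnerProductSpace ℝ E]
    [FiniteDimensional ℝ E] [MeasurableSpace E] [BorelSpace E] {M : ℝ} (hM : 0 ≤ M) :
    ∃ K : ℝ, 0 ≤ K ∧ ∀ h ∈ Icc (0 : ℝ) 1, ∀ f : E → ℝ, Measurable f →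
      (∀ x, f x ∈ Icc (gaussCDF (-M : ℝ)) (gaussCDF M)) → ∀ w : ℝ,
      gaussSmooth √(1 + h ^ 2) f 0 = gaussCDF w →
      ∫ z, (gaussSmooth 1 f (h • z) - gaussCDF w) ∂stdGaussian E = 0 ∧
      ∫ z, (gaussSmooth 1 f (h • z) - gaussCDF w) ^ 2 ∂stdGaussian E
        ≤ h ^ 2 * gaussPDF w ^ 2 + K * h ^ 3 ∧
      ∫ z, |gaussSmooth 1 f (h • z) - gaussCDF w| ^ 3 ∂stdGaussian E ≤ K * h ^ 3 := by
  have hn := integrable_norm_pow_stdGaussian (E := E)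
  set m₂ : ℝ := ∫ z : E, ‖z‖ ^ 2 ∂stdGaussian E with hm₂
  set K₂ : ℝ := ∫ z : E, (6 * ‖z‖ ^ 3 + 9 * ‖z‖ ^ 4) ∂stdGaussian E with hK₂
  set K₃ : ℝ := ∫ z : E, ((4 + 3 * m₂) * (1 + ‖z‖ ^ 2)) ^ 3 ∂stdGaussian E with hK₃
  have hm₂0 : 0 ≤ m₂ := integral_nonneg fun z ↦ by positivity
  have hK₂0 : 0 ≤ K₂ := integral_nonneg fun z ↦ by positivity
  have hK₃0 : 0 ≤ K₃ := integral_nonneg fun z ↦ by positivity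
  have hi₂ : Integrable (fun z : E ↦ 6 * ‖z‖ ^ 3 + 9 * ‖z‖ ^ 4) (stdGaussian E) :=
    ((hn 3).const_mul 6).add ((hn 4).const_mul 9)
  have hi₃ : Integrable (fun z : E ↦ ((4 + 3 * m₂) * (1 + ‖z‖ ^ 2)) ^ 3) (stdGaussian E) := by
    have : (fun z : E ↦ ((4 + 3 * m₂) * (1 + ‖z‖ ^ 2)) ^ 3)
        = fun z ↦ (4 + 3 * m₂) ^ 3 * (1 + 3 * ‖z‖ ^ 2 + 3 * ‖z‖ ^ 4 + ‖z‖ ^ 6) := by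
      funext z; ring
    rw [this]
    exact ((((integrable_const 1).add ((hn 2).const_mul 3)).add ((hn 4).const_mul 3)).add
      (hn 6)).const_mul _
  refine ⟨K₂ + 6 * M * m₂ + K₃, by positivity, ?_⟩
  rintro h ⟨h0, h1⟩ f hf hfM w hw
  have hsub : Icc (gaussCDF (-M : ℝ)) (gaussCDF M) ⊆ Icc 0 1 :=
    Icc_subset_Icc (gaussCDF_nonneg _) (gaussCDF_le_one _)
  have hf01 : ∀ x, f x ∈ Icc 0 1 := fun x ↦ hsub (hfM x)
  set q : E → ℝ := fun z ↦ gaussSmooth 1 f (h • z) with hq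
  have hqm : Measurable q := (measurable_gaussSmooth 1 hf).comp (by fun_prop)
  have hqM : ∀ z, q z ∈ Icc (gaussCDF (-M : ℝ)) (gaussCDF M) := fun z ↦
    gaussSmooth_mem_Icc 1 hf hfM _
  have hqi : Integrable q (stdGaussian E) := integrable_of_mem_Icc hqm hqM
  have hq0 : ∫ z, q z ∂stdGaussian E = gaussCDF w := by
    have := gaussSmooth_gaussSmooth h 1 hf hfM 0
    rw [one_pow, add_comm, hw] at this
    simpa [gaussSmooth, hq] using this
  set a : ℝ := ∫ y, f y ∂stdGaussian E with ha
  have haM : a ∈ Icc (gaussCDF (-M : ℝ)) (gaussCDF M) := integral_mem_Icc_of_forall hf hfM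
  obtain ⟨v, hv⟩ := exists_gaussCDF_eq ((gaussCDF_coe_pos _).trans_le haM.1)
    (haM.2.trans_lt (gaussCDF_coe_lt_one _))
  have hmem : ∀ x : ℝ, gaussCDF x ∈ Icc (gaussCDF (-M : ℝ)) (gaussCDF M) → x ∈ Icc (-M) M :=
    fun x hx ↦ ⟨strictMono_gaussCDF_coe.le_iff_le.1 hx.1, strictMono_gaussCDF_coe.le_iff_le.1 hx.2⟩
  have hvM : v ∈ Icc (-M) M := hmem v (hv ▸ haM)
  have hwM : w ∈ Icc (-M) M := hmem w (hq0 ▸ integral_mem_Icc_of_forall hqm hqM)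
  set m := gaussMoment f with hm
  have hmle : ‖m‖ ≤ gaussPDF v := norm_gaussMoment_le hf hf01 hv.symm
  have hm1 : ‖m‖ ≤ 1 := hmle.trans (gaussPDF_le_one v)
  have hR : ∀ z, |q z - a - h * ⟪m, z⟫| ≤ 3 * h ^ 2 * ‖z‖ ^ 2 := by
    intro z
    have := abs_integral_add_sub_le hf hf01 (h • z)
    rw [norm_smul, mul_pow, Real.norm_eq_abs, sq_abs, real_inner_smul_left,
      real_inner_comm] at this
    simpa [hq, gaussSmooth, add_comm, mul_assoc] using this
  have hmz : ∀ z, |⟪m, z⟫| ≤ ‖z‖ := fun z ↦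
    (abs_real_inner_le_norm m z).trans (mul_le_of_le_one_left (norm_nonneg _) hm1)
  have hqa : Integrable (fun z ↦ q z - a) (stdGaussian E) := hqi.sub (integrable_const a)
  have hdrift : |gaussCDF w - a| ≤ 3 * h ^ 2 * m₂ := by
    have e : gaussCDF w - a = ∫ z, (q z - a - h * ⟪m, z⟫) ∂stdGaussian E := by
      rw [integral_sub hqa ((integrable_inner_stdGaussian m).const_mul h),
        integral_sub hqi (integrable_const a), hq0, integral_const_mul, integral_inner_stdGaussian]
      simp
    rw [e, hm₂, ← integral_const_mul, ← Real.norm_eq_abs]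
    exact norm_integral_le_of_norm_le ((hn 2).const_mul _) (ae_of_all _ hR)
  have hsq : ∫ z, (q z - a) ^ 2 ∂stdGaussian E ≤ h ^ 2 * ‖m‖ ^ 2 + K₂ * h ^ 3 := by
    have hb : Integrable (fun z : E ↦ h ^ 2 * ⟪m, z⟫ ^ 2 + (6 * ‖z‖ ^ 3 + 9 * ‖z‖ ^ 4) * h ^ 3)
      (stdGaussian E) := ((integrable_inner_sq_stdGaussian m).const_mul _).add (hi₂.mul_const _)
    calc _ ≤ ∫ z : E, (h ^ 2 * ⟪m, z⟫ ^ 2 + (6 * ‖z‖ ^ 3 + 9 * ‖z‖ ^ 4) * h ^ 3) ∂stdGaussian E := by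
          refine integral_mono_of_nonneg (ae_of_all _ fun z ↦ sq_nonneg _) hb (ae_of_all _ fun z ↦ ?_)
          simp only
          have e : q z - a = h * ⟪m, z⟫ + (q z - a - h * ⟪m, z⟫) := by ring
          rw [e]
          set R := q z - a - h * ⟪m, z⟫
          have hRz : |R| ≤ 3 * h ^ 2 * ‖z‖ ^ 2 := hR z
          have h5 : ⟪m, z⟫ * R ≤ ‖z‖ * (3 * h ^ 2 * ‖z‖ ^ 2) := by
            refine (le_abs_self _).trans ?_
            rw [abs_mul]
            exact mul_le_mul (hmz z) hRz (abs_nonneg _) (norm_nonneg _)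
          have h6 : R ^ 2 ≤ (3 * h ^ 2 * ‖z‖ ^ 2) ^ 2 := sq_le_sq' (abs_le.1 hRz).1 (abs_le.1 hRz).2
          have h7 : h ^ 4 * ‖z‖ ^ 4 ≤ h ^ 3 * ‖z‖ ^ 4 :=
            mul_le_mul_of_nonneg_right (pow_le_pow_of_le_one h0 h1 (by norm_num)) (by positivity)
          have h8 := mul_le_mul_of_nonneg_left h5 h0
          calc (h * ⟪m, z⟫ + R) ^ 2 = h ^ 2 * ⟪m, z⟫ ^ 2 + 2 * (h * (⟪m, z⟫ * R)) + R ^ 2 := by ring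
            _ ≤ h ^ 2 * ⟪m, z⟫ ^ 2 + 2 * (h * (‖z‖ * (3 * h ^ 2 * ‖z‖ ^ 2)))
                + (3 * h ^ 2 * ‖z‖ ^ 2) ^ 2 := by linarith
            _ = h ^ 2 * ⟪m, z⟫ ^ 2 + 6 * ‖z‖ ^ 3 * h ^ 3 + 9 * (h ^ 4 * ‖z‖ ^ 4) := by ring
            _ ≤ h ^ 2 * ⟪m, z⟫ ^ 2 + 6 * ‖z‖ ^ 3 * h ^ 3 + 9 * (h ^ 3 * ‖z‖ ^ 4) := by linarith
            _ = _ := by ring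
      _ = _ := by
          rw [integral_add ((integrable_inner_sq_stdGaussian m).const_mul _) (hi₂.mul_const _),
            integral_const_mul, integral_mul_const, integral_inner_sq_stdGaussian]
  have hpdf : gaussPDF v ^ 2 ≤ gaussPDF w ^ 2 + 6 * M * m₂ * h ^ 2 := by
    have h5 := (le_abs_self _).trans (abs_gaussPDF_sub_le hwM hvM)
    rw [hv, abs_sub_comm] at h5
    have h6 : gaussPDF v - gaussPDF w ≤ M * (3 * h ^ 2 * m₂) :=
      h5.trans (mul_le_mul_of_nonneg_left hdrift hM)
    have h7 : 0 ≤ M * (3 * h ^ 2 * m₂) := by positivity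
    have h8 := gaussPDF_le_one v
    have h9 := gaussPDF_le_one w
    nlinarith [gaussPDF_pos v, gaussPDF_pos w]
  refine ⟨?_, ?_, ?_⟩
  · rw [integral_sub hqi (integrable_const _), hq0]; simp
  · have e : (fun z ↦ (q z - gaussCDF w) ^ 2)
        = fun z ↦ (q z - a) ^ 2 + ((gaussCDF w - a) ^ 2 - 2 * (gaussCDF w - a) * (q z - a)) := by
      funext z; ring
    have hqa2 : Integrable (fun z ↦ (q z - a) ^ 2) (stdGaussian E) := by
      refine integrable_of_mem_Icc (a := 0) (b := 1) (by fun_prop) fun z ↦ ⟨sq_nonneg _, ?_⟩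
      have h5 := hsub (hqM z)
      have h6 := hsub haM
      rw [sq_le_one_iff_abs_le_one, abs_le]
      constructor <;> linarith [h5.1, h5.2, h6.1, h6.2]
    have e2 : ∫ z, (q z - a) ∂stdGaussian E = gaussCDF w - a := by
      rw [integral_sub hqi (integrable_const a), hq0]; simp
    have hlin : Integrable (fun z ↦ (gaussCDF w - a) ^ 2 - 2 * (gaussCDF w - a) * (q z - a))
      (stdGaussian E) := (integrable_const _).sub (hqa.const_mul _)
    rw [e, integral_add hqa2 hlin,
      integral_sub (integrable_const _) (hqa.const_mul _), integral_const_mul, e2]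
    simp only [integral_const, probReal_univ, smul_eq_mul, one_mul]
    have h5 : h ^ 2 * ‖m‖ ^ 2 ≤ h ^ 2 * gaussPDF v ^ 2 :=
      mul_le_mul_of_nonneg_left (pow_le_pow_left₀ (norm_nonneg _) hmle 2) (sq_nonneg h)
    have h6 := mul_le_mul_of_nonneg_left hpdf (sq_nonneg h)
    have h7 : 6 * M * m₂ * h ^ 4 ≤ 6 * M * m₂ * h ^ 3 :=
      mul_le_mul_of_nonneg_left (pow_le_pow_of_le_one h0 h1 (by norm_num)) (by positivity)
    have h8 : 0 ≤ K₃ * h ^ 3 := by positivity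
    nlinarith [sq_nonneg (gaussCDF w - a)]
  · calc _ ≤ ∫ z : E, ((4 + 3 * m₂) * (1 + ‖z‖ ^ 2)) ^ 3 * h ^ 3 ∂stdGaussian E := by
          refine integral_mono_of_nonneg (ae_of_all _ fun z ↦ by positivity) (hi₃.mul_const _)
            (ae_of_all _ fun z ↦ ?_)
          simp only
          rw [← mul_pow]
          refine pow_le_pow_left₀ (abs_nonneg _) ?_ 3
          have e : q z - gaussCDF w
            = (q z - a - h * ⟪m, z⟫) + h * ⟪m, z⟫ - (gaussCDF w - a) := by ring
          have h5 : h ^ 2 ≤ h := by nlinarith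
          calc |q z - gaussCDF w|
              ≤ |q z - a - h * ⟪m, z⟫| + |h * ⟪m, z⟫| + |gaussCDF w - a| := by
                rw [e]; exact (abs_sub _ _).trans (by gcongr; exact abs_add_le _ _)
            _ ≤ 3 * h ^ 2 * ‖z‖ ^ 2 + h * ‖z‖ + 3 * h ^ 2 * m₂ := by
                rw [abs_mul, abs_of_nonneg h0]
                gcongr
                · exact hR z
                · exact hmz z
            _ ≤ 3 * h * ‖z‖ ^ 2 + h * ‖z‖ + 3 * h * m₂ := by gcongr
            _ ≤ (4 + 3 * m₂) * (1 + ‖z‖ ^ 2) * h := by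
                have h6 : ‖z‖ ≤ 1 + ‖z‖ ^ 2 := by nlinarith [sq_nonneg (‖z‖ - 1)]
                have h7 := mul_le_mul_of_nonneg_left h6 h0
                have h8 : 0 ≤ m₂ * ‖z‖ ^ 2 * h := by positivity
                nlinarith
      _ = K₃ * h ^ 3 := integral_mul_const _ _
      _ ≤ _ := by
          refine mul_le_mul_of_nonneg_right ?_ (by positivity)
          have : 0 ≤ 6 * M * m₂ := by positivity
          linarith

/-- One step of the semigroup interpolation, with an error of smaller order than the variance `h²`
of the step. -/
lemma exists_gaussSmooth_step (E : Type*) [NormedAddCommGroup E] [InnerProductSpace ℝ E]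
    [FiniteDimensional ℝ E] [MeasurableSpace E] [BorelSpace E] {C M : ℝ} (hC : 0 ≤ C)
    (hM : 0 ≤ M) :
    ∃ K : ℝ, 0 ≤ K ∧ ∀ h ∈ Icc (0 : ℝ) 1, ∀ c ∈ Icc 0 C, ∀ f : E → ℝ, Measurable f →
      (∀ x, f x ∈ Icc (gaussCDF (-M : ℝ)) (gaussCDF M)) →
      gaussShift (c / √(1 + h ^ 2)) (gaussSmooth √(1 + h ^ 2) f 0)
        ≤ gaussSmooth h (fun z ↦ gaussShift c (gaussSmooth 1 f z)) 0 + K * h ^ 3 := by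
  obtain ⟨K₁, hK₁, hmom⟩ := exists_gaussSmooth_moment_bounds E hM
  obtain ⟨A, hA, htaylor⟩ := exists_gaussShift_taylor C M
  have hcont : Continuous fun p : ℝ × ℝ ↦
      p.1 * (Real.exp (-p.1 * p.2 - p.1 ^ 2 / 2) * (gaussPDF p.2)⁻¹) := by
    have : Continuous fun p : ℝ × ℝ ↦ (gaussPDF p.2)⁻¹ :=
      (continuous_gaussPDF.comp continuous_snd).inv₀ fun p ↦ (gaussPDF_pos p.2).ne'
    fun_prop
  obtain ⟨B', hB'⟩ := ((isCompact_Icc (a := (0 : ℝ)) (b := C)).prod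
    (isCompact_Icc (a := -M) (b := M))).exists_bound_of_continuousOn hcont.continuousOn
  set B := max B' 0
  have hB0 : 0 ≤ B := le_max_right _ _
  refine ⟨A * K₁ + B / 2 * K₁ + C + C ^ 2, by positivity, ?_⟩
  rintro h ⟨h0, h1⟩ c ⟨hc0, hcC⟩ f hf hfM
  have hsub : Icc (gaussCDF (-M : ℝ)) (gaussCDF M) ⊆ Ioo 0 1 := fun t ht ↦
    ⟨(gaussCDF_coe_pos _).trans_le ht.1, ht.2.trans_lt (gaussCDF_coe_lt_one _)⟩
  have hq0M := gaussSmooth_mem_Icc √(1 + h ^ 2) hf hfM 0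
  obtain ⟨w, hw⟩ := exists_gaussCDF_eq (hsub hq0M).1 (hsub hq0M).2
  obtain ⟨hm1, hm2, hm3⟩ := hmom h ⟨h0, h1⟩ f hf hfM w hw.symm
  rw [← hw] at hq0M ⊢
  have hwM : w ∈ Icc (-M) M :=
    ⟨strictMono_gaussCDF_coe.le_iff_le.1 hq0M.1, strictMono_gaussCDF_coe.le_iff_le.1 hq0M.2⟩
  set q : E → ℝ := fun z ↦ gaussSmooth 1 f (h • z) with hq
  have hqm : Measurable q := (measurable_gaussSmooth 1 hf).comp (by fun_prop)
  have hqM : ∀ z, q z ∈ Icc (gaussCDF (-M : ℝ)) (gaussCDF M) := fun z ↦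
    gaussSmooth_mem_Icc 1 hf hfM _
  have hD : ∀ z, |q z - gaussCDF w| ≤ 1 := fun z ↦ by
    have h5 := hsub (hqM z)
    have h6 := hsub hq0M
    rw [abs_le]; constructor <;> linarith [h5.1, h5.2, h6.1, h6.2]
  have hi1 : Integrable (fun z ↦ q z - gaussCDF w) (stdGaussian E) :=
    (integrable_of_mem_Icc hqm hqM).sub (integrable_const _)
  have hi2 : Integrable (fun z ↦ (q z - gaussCDF w) ^ 2) (stdGaussian E) :=
    integrable_of_mem_Icc (a := 0) (b := 1) (by fun_prop) fun z ↦
      ⟨sq_nonneg _, (sq_le_one_iff_abs_le_one _).2 (hD z)⟩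
  have hi3 : Integrable (fun z ↦ |q z - gaussCDF w| ^ 3) (stdGaussian E) :=
    integrable_of_mem_Icc (a := 0) (b := 1) (by fun_prop) fun z ↦
      ⟨by positivity, pow_le_one₀ (abs_nonneg _) (hD z)⟩
  set D₁ := gaussShiftDeriv c (gaussCDF w) with hD₁
  set D₂ := gaussShiftDeriv₂ c (gaussCDF w) with hD₂
  have hD₂eq : D₂ = -(c * (Real.exp (-c * w - c ^ 2 / 2) * (gaussPDF w)⁻¹)) := by
    rw [hD₂, gaussShiftDeriv₂, gaussShiftDeriv, gaussQuantile_toReal_gaussCDF]; ring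
  have hD₂pdf : D₂ * gaussPDF w ^ 2 = -(c * gaussPDF (w + c)) := by
    have := (gaussPDF_pos w).ne'
    rw [hD₂eq, gaussPDF_add]; field_simp
  have hD₂B : -D₂ ≤ B := by
    rw [hD₂eq, neg_neg]
    exact (le_abs_self _).trans ((hB' (c, w) ⟨⟨hc0, hcC⟩, hwM⟩).trans (le_max_left _ _))
  have hD₂0 : D₂ ≤ 0 := by
    rw [hD₂eq, neg_nonpos]
    have := gaussPDF_pos w
    positivity
  have hlow : gaussCDF ((w + c : ℝ) : EReal) + D₂ / 2 * (h ^ 2 * gaussPDF w ^ 2 + K₁ * h ^ 3)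
      - A * (K₁ * h ^ 3) ≤ gaussSmooth h (fun z ↦ gaussShift c (gaussSmooth 1 f z)) 0 := by
    have e : gaussSmooth h (fun z ↦ gaussShift c (gaussSmooth 1 f z)) 0
        = ∫ z, gaussShift c (q z) ∂stdGaussian E := by simp [gaussSmooth, hq]
    have hlin : Integrable (fun z ↦ gaussShift c (gaussCDF w) + D₁ * (q z - gaussCDF w))
      (stdGaussian E) := (integrable_const _).add (hi1.const_mul _)
    have hquad : Integrable (fun z ↦ gaussShift c (gaussCDF w) + D₁ * (q z - gaussCDF w)
      + D₂ / 2 * (q z - gaussCDF w) ^ 2) (stdGaussian E) := hlin.add (hi2.const_mul _)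
    have hle : ∫ z, (gaussShift c (gaussCDF w) + D₁ * (q z - gaussCDF w)
        + D₂ / 2 * (q z - gaussCDF w) ^ 2 - A * |q z - gaussCDF w| ^ 3) ∂stdGaussian E
        ≤ ∫ z, gaussShift c (q z) ∂stdGaussian E :=
      integral_mono (hquad.sub (hi3.const_mul A))
        (integrable_of_mem_Icc ((gaussShift_mono c).measurable.comp hqm) fun z ↦
          ⟨gaussShift_nonneg _ _, gaussShift_le_one _ _⟩)
        fun z ↦ htaylor c ⟨hc0, hcC⟩ _ hq0M _ (hqM z)
    rw [integral_sub hquad (hi3.const_mul A), integral_add hlin (hi2.const_mul _),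
      integral_add (integrable_const _) (hi1.const_mul _), integral_const_mul, integral_const_mul,
      integral_const_mul, hm1, gaussShift_gaussCDF] at hle
    simp only [integral_const, probReal_univ, smul_eq_mul, one_mul, mul_zero, add_zero] at hle
    rw [e]
    have h5 := mul_le_mul_of_nonneg_left hm3 hA
    have h6 := mul_le_mul_of_nonpos_left hm2 (by linarith : D₂ / 2 ≤ 0)
    linarith
  have hup := gaussCDF_le_taylor (w + c) (w + c / √(1 + h ^ 2))
  rw [gaussShift_gaussCDF]
  obtain ⟨hr1, hr2⟩ := one_div_sqrt_one_add_sq_bounds h0 h1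
  have hp0 := gaussPDF_pos (w + c)
  have hp1 := gaussPDF_le_one (w + c)
  have hr3 : 1 / √(1 + h ^ 2) ≤ 1 := by
    rw [div_le_one (by positivity), Real.one_le_sqrt]
    nlinarith
  have e1 : w + c / √(1 + h ^ 2) - (w + c) = -(c * (1 - 1 / √(1 + h ^ 2))) := by ring
  rw [e1] at hup
  set r := 1 / √(1 + h ^ 2)
  have hh : h ^ 4 ≤ h ^ 3 := pow_le_pow_of_le_one h0 h1 (by norm_num)
  have h5 : gaussPDF (w + c) * -(c * (1 - r))
      ≤ -(c * gaussPDF (w + c)) * (h ^ 2 / 2) + C * h ^ 3 := by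
    have h6 : -(c * (1 - r)) ≤ c * (-(h ^ 2 / 2) + h ^ 4) := by nlinarith
    have h7 := mul_le_mul_of_nonneg_left h6 hp0.le
    have h8 : gaussPDF (w + c) * c * h ^ 4 ≤ 1 * C * h ^ 3 := by gcongr
    linarith
  have h6 : (-(c * (1 - r))) ^ 2 ≤ C ^ 2 * h ^ 3 := by
    have h7 : c * (1 - r) ≤ C * h ^ 2 := by
      apply mul_le_mul hcC _ _ hC <;> linarith
    have h8 : (c * (1 - r)) ^ 2 ≤ (C * h ^ 2) ^ 2 :=
      pow_le_pow_left₀ (mul_nonneg hc0 (by linarith)) h7 2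
    have h9 := mul_le_mul_of_nonneg_left hh (sq_nonneg C)
    rw [neg_sq]
    linarith [show (C * h ^ 2) ^ 2 = C ^ 2 * h ^ 4 by ring]
  have h7 : -(B / 2 * (K₁ * h ^ 3)) ≤ D₂ / 2 * (K₁ * h ^ 3) := by
    have := mul_le_mul_of_nonneg_right hD₂B (by positivity : 0 ≤ K₁ * h ^ 3)
    linarith
  have h8 : D₂ / 2 * (h ^ 2 * gaussPDF w ^ 2) = -(c * gaussPDF (w + c)) * (h ^ 2 / 2) := by
    rw [← hD₂pdf]; ring
  have h9 : (A * K₁ + B / 2 * K₁ + C + C ^ 2) * h ^ 3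
      = A * (K₁ * h ^ 3) + B / 2 * (K₁ * h ^ 3) + C * h ^ 3 + C ^ 2 * h ^ 3 := by ring
  rw [h9]
  rw [mul_add, h8] at hlow
  linarith

end Step

/-! ### Semigroup interpolation -/

section Interpolation

variable {E : Type*} [NormedAddCommGroup E] [InnerProductSpace ℝ E] [FiniteDimensional ℝ E]
  [MeasurableSpace E] [BorelSpace E]

lemma measurable_gaussShift_gaussSmooth (c σ : ℝ) {f : E → ℝ} (hf : Measurable f) :
    Measurable fun z ↦ gaussShift c (gaussSmooth σ f z) :=
  (gaussShift_mono c).measurable.comp (measurable_gaussSmooth σ hf)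

lemma gaussShift_mem_Icc (c a : ℝ) : gaussShift c a ∈ Icc 0 1 :=
  ⟨gaussShift_nonneg c a, gaussShift_le_one c a⟩

lemma gaussSmooth_mono {σ : ℝ} {f g : E → ℝ} (hf : Measurable f) (hg : Measurable g) {a b a' b' : ℝ}
    (hfb : ∀ x, f x ∈ Icc a b) (hgb : ∀ x, g x ∈ Icc a' b') (h : ∀ x, f x ≤ g x) (x : E) :
    gaussSmooth σ f x ≤ gaussSmooth σ g x :=
  integral_mono (integrable_of_mem_Icc (by fun_prop) fun _ ↦ hfb _)
    (integrable_of_mem_Icc (by fun_prop) fun _ ↦ hgb _) fun _ ↦ h _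

/-- The rescaled interpolation inequality between the scales `σ` and `σ b`. -/
lemma gaussShift_rescale {c c' b h e : ℝ} {s : Set ℝ}
    (H : ∀ f : E → ℝ, Measurable f → (∀ x, f x ∈ s) →
      gaussShift c' (gaussSmooth b f 0)
        ≤ gaussSmooth h (fun z ↦ gaussShift c (gaussSmooth 1 f z)) 0 + e)
    (σ : ℝ) {f : E → ℝ} (hf : Measurable f) (hfs : ∀ x, f x ∈ s) (x : E) :
    gaussShift c' (gaussSmooth (σ * b) f x)
      ≤ gaussSmooth (σ * h) (fun z ↦ gaussShift c (gaussSmooth σ f z)) x + e := by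
  have h1 := H (fun y ↦ f (x + σ • y)) (by fun_prop) fun _ ↦ hfs _
  simp_rw [gaussSmooth_mul] at h1
  have h2 := gaussSmooth_mul σ h (fun z ↦ gaussShift c (gaussSmooth σ f z)) x 0
  rw [smul_zero, add_zero] at h2 h1
  rwa [mul_one, h2] at h1

lemma gaussShift_iterate {C K h : ℝ} {s : Set ℝ}
    (H : ∀ c ∈ Icc 0 C, ∀ f : E → ℝ, Measurable f → (∀ x, f x ∈ s) →
      gaussShift (c / √(1 + h ^ 2)) (gaussSmooth √(1 + h ^ 2) f 0)
        ≤ gaussSmooth h (fun z ↦ gaussShift c (gaussSmooth 1 f z)) 0 + K)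
    (n : ℕ) {c : ℝ} (hc : c ∈ Icc 0 C) {f : E → ℝ} (hf : Measurable f) (hfs : ∀ x, f x ∈ s)
    (x : E) :
    gaussShift (c / √(1 + h ^ 2) ^ n) (gaussSmooth (√(1 + h ^ 2) ^ n) f x)
      ≤ gaussSmooth √((√(1 + h ^ 2) ^ n) ^ 2 - 1) (fun z ↦ gaussShift c (gaussSmooth 1 f z)) x
        + n * K := by
  have hs1 : 1 ≤ √(1 + h ^ 2) := by rw [Real.one_le_sqrt]; nlinarith
  have hsq : √(1 + h ^ 2) ^ 2 = 1 + h ^ 2 := Real.sq_sqrt (by positivity)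
  set t := √(1 + h ^ 2)
  induction n generalizing x with
  | zero => simp [gaussSmooth]
  | succ n ih =>
    have htn : 1 ≤ t ^ n := one_le_pow₀ hs1
    have hcn : c / t ^ n ∈ Icc 0 C :=
      ⟨div_nonneg hc.1 (by positivity), (div_le_self hc.1 htn).trans hc.2⟩
    have h1 := gaussShift_rescale (H _ hcn) (t ^ n) hf hfs x
    have hG := measurable_gaussShift_gaussSmooth c 1 hf
    have h2 : gaussSmooth (t ^ n * h) (fun z ↦ gaussShift (c / t ^ n) (gaussSmooth (t ^ n) f z)) x
        ≤ gaussSmooth (t ^ n * h) (fun z ↦ gaussSmooth √((t ^ n) ^ 2 - 1)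
          (fun z ↦ gaussShift c (gaussSmooth 1 f z)) z + n * K) x :=
      gaussSmooth_mono (measurable_gaussShift_gaussSmooth _ _ hf)
        ((measurable_gaussSmooth _ hG).add_const _) (fun _ ↦ gaussShift_mem_Icc _ _)
        (a' := 0 + n * K) (b' := 1 + n * K)
        (fun z ↦ by
          have := gaussSmooth_mem_Icc √((t ^ n) ^ 2 - 1) hG (fun _ ↦ gaussShift_mem_Icc _ _) z
          exact ⟨by linarith [this.1], by linarith [this.2]⟩)
        ih x
    have h3 : gaussSmooth (t ^ n * h) (fun z ↦ gaussSmooth √((t ^ n) ^ 2 - 1)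
        (fun z ↦ gaussShift c (gaussSmooth 1 f z)) z + n * K) x
        = gaussSmooth √((t ^ (n + 1)) ^ 2 - 1) (fun z ↦ gaussShift c (gaussSmooth 1 f z)) x
          + n * K := by
      have h4 := gaussSmooth_gaussSmooth (t ^ n * h) √((t ^ n) ^ 2 - 1) hG
        (fun _ ↦ gaussShift_mem_Icc _ _) x
      have h5 : (t ^ n * h) ^ 2 + √((t ^ n) ^ 2 - 1) ^ 2 = (t ^ (n + 1)) ^ 2 - 1 := by
        rw [Real.sq_sqrt (by nlinarith), pow_succ t n, mul_pow, mul_pow, hsq]; ring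
      rw [h5] at h4
      rw [← h4, gaussSmooth, gaussSmooth, integral_add _ (integrable_const _)]
      · simp
      · exact integrable_of_mem_Icc (a := 0) (b := 1)
          ((measurable_gaussSmooth _ hG).comp (by fun_prop))
          fun z ↦ gaussSmooth_mem_Icc _ hG (fun _ ↦ gaussShift_mem_Icc _ _) _
    have e1 : c / t ^ n / t = c / t ^ (n + 1) := by rw [div_div, pow_succ]
    rw [e1, ← pow_succ] at h1
    push_cast
    linarith

lemma gaussShift_gaussSmooth_le_of_mem_Icc {M : ℝ} (hM : 0 ≤ M) {c b : ℝ} (hc : 0 ≤ c)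
    (hb : 1 ≤ b) {f : E → ℝ} (hf : Measurable f)
    (hfM : ∀ x, f x ∈ Icc (gaussCDF (-M : ℝ)) (gaussCDF M)) :
    gaussShift (c / b) (gaussSmooth b f 0)
      ≤ gaussSmooth √(b ^ 2 - 1) (fun z ↦ gaussShift c (gaussSmooth 1 f z)) 0 := by
  obtain ⟨K, hK, hstep⟩ := exists_gaussSmooth_step E hc hM
  let t : ℕ → ℝ := fun n ↦ b ^ ((n : ℝ)⁻¹)
  let h : ℕ → ℝ := fun n ↦ √(t n ^ 2 - 1)
  have hb0 : 0 ≤ b := by linarith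
  have ht1 : ∀ n, 1 ≤ t n := fun n ↦ Real.one_le_rpow hb (by positivity)
  have htn : ∀ n, n ≠ 0 → t n ^ n = b := fun n hn ↦ Real.rpow_inv_natCast_pow hb0 hn
  have hh2 : ∀ n, h n ^ 2 = t n ^ 2 - 1 := fun n ↦ Real.sq_sqrt (by nlinarith [ht1 n])
  have hts : ∀ n, √(1 + h n ^ 2) = t n := fun n ↦ by
    rw [hh2, add_sub_cancel, Real.sqrt_sq (by linarith [ht1 n])]
  have hnh : ∀ n : ℕ, n ≠ 0 → n * h n ^ 2 ≤ b ^ 2 - 1 := fun n hn ↦ by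
    have h1 := one_add_mul_le_pow (a := t n ^ 2 - 1) (by nlinarith [ht1 n]) n
    rw [add_sub_cancel, ← pow_mul, mul_comm 2 n, pow_mul, htn n hn] at h1
    rw [hh2]; linarith
  have hlim : Tendsto h atTop (𝓝 0) := by
    have h1 : Tendsto t atTop (𝓝 1) := by
      have h2 : Tendsto (fun n : ℕ ↦ ((n : ℝ)⁻¹)) atTop (𝓝 0) := tendsto_inv_atTop_nhds_zero_nat
      have h3 := (Real.continuousAt_const_rpow (a := b) (b := 0) (by linarith)).tendsto.comp h2
      rwa [Real.rpow_zero] at h3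
    have h2 := ((h1.pow 2).sub_const 1).sqrt
    simpa using h2
  have hbound : ∀ᶠ n in atTop, gaussShift (c / b) (gaussSmooth b f 0)
      ≤ gaussSmooth √(b ^ 2 - 1) (fun z ↦ gaussShift c (gaussSmooth 1 f z)) 0
        + K * (b ^ 2 - 1) * h n := by
    filter_upwards [eventually_ne_atTop 0, hlim.eventually_le_const one_pos] with n hn hn1
    have hn0 : 0 ≤ h n := Real.sqrt_nonneg _
    have h1 := gaussShift_iterate (h := h n) (C := c) (K := K * h n ^ 3)
      (fun c' hc' f hf hfs ↦ hstep (h n) ⟨hn0, hn1⟩ c' hc' f hf hfs) n ⟨hc, le_rfl⟩ hf hfM 0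
    rw [hts, htn n hn] at h1
    have h2 := mul_le_mul_of_nonneg_left (hnh n hn) (mul_nonneg hK hn0)
    linarith [show (n : ℝ) * (K * h n ^ 3) = K * h n * (n * h n ^ 2) by ring]
  have hlim2 : Tendsto (fun n ↦ gaussSmooth √(b ^ 2 - 1)
      (fun z ↦ gaussShift c (gaussSmooth 1 f z)) (0 : E) + K * (b ^ 2 - 1) * h n) atTop
      (𝓝 (gaussSmooth √(b ^ 2 - 1) (fun z ↦ gaussShift c (gaussSmooth 1 f z)) (0 : E)
        + K * (b ^ 2 - 1) * 0)) := (hlim.const_mul _).const_add _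
  have := ge_of_tendsto hlim2 hbound
  simpa using this

lemma gaussSmooth_const_add_mul (σ k l : ℝ) {f : E → ℝ} (hf : Measurable f)
    (hf01 : ∀ x, f x ∈ Icc 0 1) (x : E) :
    gaussSmooth σ (fun y ↦ k + l * f y) x = k + l * gaussSmooth σ f x := by
  have hi : Integrable (fun y ↦ f (x + σ • y)) (stdGaussian E) :=
    integrable_of_mem_Icc (by fun_prop) fun _ ↦ hf01 _
  rw [gaussSmooth, integral_add (integrable_const _) (hi.const_mul l), integral_const_mul]
  simp [gaussSmooth]

/-- Interpolation along the heat semigroup between the scales `1` and `b`. -/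
lemma gaussShift_gaussSmooth_le {c b : ℝ} (hc : 0 ≤ c) (hb : 1 ≤ b) {f : E → ℝ}
    (hf : Measurable f) (hf01 : ∀ x, f x ∈ Icc 0 1) :
    gaussShift (c / b) (gaussSmooth b f 0)
      ≤ gaussSmooth √(b ^ 2 - 1) (fun z ↦ gaussShift c (gaussSmooth 1 f z)) 0 := by
  let k : ℕ → ℝ := fun n ↦ gaussCDF (-(n : ℝ) : ℝ)
  let l : ℕ → ℝ := fun n ↦ gaussCDF (n : ℝ) - k n
  have hk : Tendsto k atTop (𝓝 0) :=
    tendsto_gaussCDF_atBot.comp (tendsto_neg_atTop_atBot.comp tendsto_natCast_atTop_atTop)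
  have hl : Tendsto l atTop (𝓝 1) := by
    rw [← sub_zero (1 : ℝ)]
    exact (tendsto_gaussCDF_atTop.comp tendsto_natCast_atTop_atTop).sub hk
  have hl0 : ∀ n, 0 ≤ l n := fun n ↦ sub_nonneg.2 <|
    strictMono_gaussCDF_coe.monotone (neg_le_self (Nat.cast_nonneg n))
  have hlim : ∀ σ (x : E), Tendsto (fun n ↦ gaussSmooth σ (fun y ↦ k n + l n * f y) x) atTop
      (𝓝 (gaussSmooth σ f x)) := fun σ x ↦ by
    simp_rw [gaussSmooth_const_add_mul σ _ _ hf hf01]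
    simpa using hk.add (hl.mul_const (gaussSmooth σ f x))
  have h1 : ∀ n, gaussShift (c / b) (gaussSmooth b (fun y ↦ k n + l n * f y) (0 : E))
      ≤ gaussSmooth √(b ^ 2 - 1)
        (fun z ↦ gaussShift c (gaussSmooth 1 (fun y ↦ k n + l n * f y) z)) 0 := fun n ↦ by
    refine gaussShift_gaussSmooth_le_of_mem_Icc (Nat.cast_nonneg n) hc hb (by fun_prop) fun x ↦ ?_
    have h2 := mul_nonneg (hl0 n) (hf01 x).1
    have h3 := mul_le_of_le_one_right (hl0 n) (hf01 x).2
    have h4 : l n = gaussCDF (n : ℝ) - k n := rfl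
    exact ⟨by simpa [k] using h2, by linarith⟩
  refine le_of_tendsto_of_tendsto' (((continuous_gaussShift _).tendsto _).comp (hlim b 0)) ?_ h1
  refine tendsto_integral_of_dominated_convergence (fun _ ↦ 1) (fun n ↦ ?_) (integrable_const 1)
    (fun n ↦ ae_of_all _ fun y ↦ ?_) (ae_of_all _ fun y ↦ ?_)
  · have h5 : Measurable fun y ↦ k n + l n * f y := by fun_prop
    exact ((measurable_gaussShift_gaussSmooth c 1 h5).comp (by fun_prop)).aestronglyMeasurable
  · rw [Real.norm_eq_abs, abs_of_nonneg (gaussShift_nonneg _ _)]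
    exact gaussShift_le_one _ _
  · exact ((continuous_gaussShift _).tendsto _).comp (hlim 1 _)

lemma gaussShift_integral_le {t b : ℝ} (ht : 0 ≤ t) (hb : 1 ≤ b) {f : E → ℝ}
    (hf : Measurable f) (hf01 : ∀ x, f x ∈ Icc 0 1) :
    gaussShift t (∫ y, f y ∂stdGaussian E)
      ≤ ∫ y, gaussShift (t * b) (gaussSmooth b⁻¹ f (√(1 - b⁻¹ ^ 2) • y)) ∂stdGaussian E := by
  have hb0 : 0 < b := by linarith
  have h1 := gaussShift_rescale (E := E) (c := t * b) (c' := t * b / b) (b := b)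
    (h := √(b ^ 2 - 1)) (e := 0) (s := Icc 0 1)
    (fun f hf hfs ↦ by
      simpa using gaussShift_gaussSmooth_le (mul_nonneg ht hb0.le) hb hf hfs) b⁻¹ hf hf01 0
  have h2 : b⁻¹ * √(b ^ 2 - 1) = √(1 - b⁻¹ ^ 2) := by
    rw [← Real.sqrt_sq (inv_nonneg.2 hb0.le), ← Real.sqrt_mul (sq_nonneg _),
      Real.sqrt_sq (inv_nonneg.2 hb0.le)]
    congr 1
    field_simp
  rw [mul_div_cancel_right₀ _ hb0.ne', inv_mul_cancel₀ hb0.ne', h2] at h1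
  simpa [gaussSmooth] using h1

end Interpolation

/-! ### The Gaussian isoperimetric inequality -/

section Isoperimetry

variable {E : Type*} [NormedAddCommGroup E] [InnerProductSpace ℝ E] [FiniteDimensional ℝ E]
  [MeasurableSpace E] [BorelSpace E]

lemma integrable_exp_sq_gaussianReal {β : ℝ} (hβ : β < 1) :
    Integrable (fun x : ℝ ↦ Real.exp (β * x ^ 2 / 2)) (gaussianReal 0 1) := by
  rw [gaussianReal_of_var_ne_zero 0 one_ne_zero, integrable_withDensity_iff_integrable_smul'
    (measurable_gaussianPDF 0 1) (ae_of_all _ fun _ ↦ gaussianPDF_lt_top)]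
  refine ((integrable_exp_neg_mul_sq (b := (1 - β) / 2) (by linarith)).const_mul
    (√(2 * Real.pi))⁻¹).congr (ae_of_all _ fun x ↦ ?_)
  simp only [toReal_gaussianPDF, smul_eq_mul]
  change _ = gaussPDF x * _
  rw [gaussPDF_eq, mul_assoc, ← Real.exp_add]
  congr 2
  ring

lemma integrable_exp_norm_sq_stdGaussian {β : ℝ} (hβ : β < 1) :
    Integrable (fun x : E ↦ Real.exp (β * ‖x‖ ^ 2 / 2)) (stdGaussian E) := by
  rw [stdGaussian, integrable_map_measure (Measurable.aestronglyMeasurable (by fun_prop))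
    (Measurable.aemeasurable (by fun_prop))]
  refine (Integrable.fintype_prod (f := fun _ x ↦ Real.exp (β * x ^ 2 / 2))
    fun _ ↦ integrable_exp_sq_gaussianReal hβ).congr (ae_of_all _ fun x ↦ ?_)
  simp only [Function.comp_apply]
  rw [← Real.exp_sum, ← (stdOrthonormalBasis ℝ E).sum_sq_norm_inner_right, ← Finset.sum_div,
    ← Finset.mul_sum]
  congr 3
  refine Finset.sum_congr rfl fun i _ ↦ ?_
  rw [inner_sum]
  simp [inner_smul_right, OrthonormalBasis.inner_eq_ite]

/-- The Gaussian tail decays like `exp (-β R² / 2)` for every `β < 1`. -/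
lemma exists_stdGaussian_tail_le (E : Type*) [NormedAddCommGroup E] [InnerProductSpace ℝ E]
    [FiniteDimensional ℝ E] [MeasurableSpace E] [BorelSpace E] {β : ℝ} (hβ : β < 1)
    (hβ0 : 0 ≤ β) :
    ∃ K : ℝ, 0 < K ∧ ∀ R, 0 ≤ R →
      (stdGaussian E).real {y | R ≤ ‖y‖} ≤ K * Real.exp (-(β * R ^ 2 / 2)) := by
  refine ⟨∫ x : E, Real.exp (β * ‖x‖ ^ 2 / 2) ∂stdGaussian E,
    integral_exp_pos (integrable_exp_norm_sq_stdGaussian hβ), fun R hR ↦ ?_⟩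
  have h := mul_meas_ge_le_integral_of_nonneg (ae_of_all _ fun x ↦ (Real.exp_pos _).le)
    (integrable_exp_norm_sq_stdGaussian (E := E) hβ) (Real.exp (β * R ^ 2 / 2))
  rw [Real.exp_neg, ← div_eq_mul_inv, le_div_iff₀ (Real.exp_pos _), mul_comm]
  refine le_trans (mul_le_mul_of_nonneg_left (measureReal_mono fun y (hy : R ≤ ‖y‖) ↦ ?_)
    (Real.exp_pos _).le) h
  simp only [mem_ofPred_eq]
  gcongr

lemma gaussPDF_le_gaussCDF_neg {u : ℝ} (hu : 0 ≤ u) : gaussPDF (u + 1) ≤ gaussCDF (-u : ℝ) := by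
  have h1 := gaussCDF_sub (-u - 1) (-u)
  have h2 : ∫ x in (-u - 1)..(-u), gaussPDF (u + 1) ≤ ∫ x in (-u - 1)..(-u), gaussPDF x := by
    refine intervalIntegral.integral_mono_on (by linarith) intervalIntegrable_const
      (continuous_gaussPDF.intervalIntegrable _ _) fun x hx ↦ ?_
    rw [gaussPDF_eq, gaussPDF_eq]
    refine mul_le_mul_of_nonneg_left (Real.exp_le_exp.2 ?_) (by positivity)
    nlinarith [mul_nonneg (by linarith [hx.2] : 0 ≤ u + 1 - x) (by linarith [hx.1] : 0 ≤ u + 1 + x)]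
  rw [intervalIntegral.integral_const, smul_eq_mul] at h2
  have := gaussCDF_nonneg ((-u - 1 : ℝ) : EReal)
  linarith

/-- The far tail of the Gaussian norm is negligible with respect to half-spaces at a smaller
distance. -/
lemma eventually_tail_le (E : Type*) [NormedAddCommGroup E] [InnerProductSpace ℝ E]
    [FiniteDimensional ℝ E] [MeasurableSpace E] [BorelSpace E] {t ρ : ℝ} (ht : 0 ≤ t) (hρ : t < ρ)
    (N : ℝ) (hN : 0 ≤ N) :
    ∀ᶠ b : ℝ in atTop, (stdGaussian E).real {y | ρ * b ≤ ‖y‖} ≤ gaussCDF (-(N + t * b) : ℝ) := by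
  have hρ0 : 0 < ρ := ht.trans_lt hρ
  obtain ⟨β, hβ1, hβ2⟩ := exists_between ((div_lt_one (by positivity)).2
    (pow_lt_pow_left₀ hρ ht two_ne_zero) : t ^ 2 / ρ ^ 2 < 1)
  have hβ0 : 0 ≤ β := (by positivity : 0 ≤ t ^ 2 / ρ ^ 2).trans hβ1.le
  obtain ⟨K, hK, htail⟩ := exists_stdGaussian_tail_le E hβ2 hβ0
  have hκ : 0 < β * ρ ^ 2 - t ^ 2 := by
    rw [div_lt_iff₀ (by positivity)] at hβ1; linarith
  have hlim : Tendsto (fun b : ℝ ↦ b * ((β * ρ ^ 2 - t ^ 2) / 2 * b - t * (N + 1)) +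
      -((N + 1) ^ 2 / 2)) atTop atTop := by
    refine tendsto_atTop_add_const_right _ _ (tendsto_id.atTop_mul_atTop₀ ?_)
    exact tendsto_atTop_add_const_right _ _ (tendsto_id.const_mul_atTop (by positivity))
  have hexp := (Real.tendsto_exp_atTop.comp hlim).eventually_ge_atTop (K * √(2 * Real.pi))
  filter_upwards [hexp, eventually_ge_atTop 0] with b hb hb0
  refine (htail (ρ * b) (by positivity)).trans
    (le_trans ?_ (gaussPDF_le_gaussCDF_neg (by positivity)))
  have hpi : 0 < √(2 * Real.pi) := by positivity
  simp only [Function.comp_apply] at hb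
  rw [gaussPDF_eq, ← div_eq_inv_mul, le_div_iff₀ hpi, mul_right_comm]
  refine (mul_le_mul_of_nonneg_right hb (Real.exp_pos _).le).trans (le_of_eq ?_)
  rw [← Real.exp_add]
  congr 1
  ring

lemma gaussShift_le_measureReal_cthickening {A : Set E} (hA : MeasurableSet A) {t ρ : ℝ}
    (ht : 0 ≤ t) (hρ : t < ρ) :
    gaussShift t ((stdGaussian E).real A) ≤ (stdGaussian E).real (Metric.cthickening ρ A) := by
  set f : E → ℝ := A.indicator fun _ ↦ 1 with hf
  have hfm : Measurable f := measurable_const.indicator hA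
  have hf01 : ∀ x, f x ∈ Icc 0 1 := fun x ↦ by
    by_cases hx : x ∈ A <;> simp [hf, hx]
  have hfint : ∫ y, f y ∂stdGaussian E = (stdGaussian E).real A := by
    rw [hf, integral_indicator_const _ hA, smul_eq_mul, mul_one]
  set S := Metric.cthickening ρ A
  have hS : MeasurableSet S := Metric.isClosed_cthickening.measurableSet
  let G : ℕ → E → ℝ := fun n y ↦ gaussShift (t * n) (gaussSmooth (n : ℝ)⁻¹ f y)
  have hG : ∀ n y, G n y ∈ Icc 0 1 := fun n y ↦ gaussShift_mem_Icc _ _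
  have hGm : ∀ n, Measurable (G n) := fun n ↦ measurable_gaussShift_gaussSmooth _ _ hfm
  have hsmooth : ∀ (b : ℝ), 0 < b → ∀ x ∉ S,
      gaussSmooth b⁻¹ f x ≤ (stdGaussian E).real {y | ρ * b ≤ ‖y‖} := by
    intro b hb x hx
    have hms : MeasurableSet {y : E | ρ * b ≤ ‖y‖} := measurableSet_le (by fun_prop) (by fun_prop)
    rw [← mul_one ((stdGaussian E).real _), ← smul_eq_mul, ← integral_indicator_const _ hms]
    refine integral_mono (integrable_of_mem_Icc (by fun_prop) fun _ ↦ hf01 _)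
      ((integrable_const _).indicator hms) fun y ↦ ?_
    by_cases hy : x + b⁻¹ • y ∈ A
    · have h1 : ρ < dist x (x + b⁻¹ • y) := by
        by_contra! hc
        exact hx (Metric.mem_cthickening_of_dist_le _ _ _ _ hy hc)
      rw [dist_self_add_right, norm_smul, Real.norm_eq_abs, abs_of_pos (inv_pos.2 hb),
        ← div_eq_inv_mul, lt_div_iff₀ hb] at h1
      have h2 : y ∈ {y : E | ρ * b ≤ ‖y‖} := h1.le
      simp only [indicator_of_mem h2]
      exact (hf01 _).2
    · simp only [hf, indicator_of_notMem hy]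
      exact indicator_nonneg (fun _ _ ↦ zero_le_one) _
  have hzero : ∀ y ∉ S, Tendsto (fun n : ℕ ↦ G n (√(1 - (n : ℝ)⁻¹ ^ 2) • y)) atTop (𝓝 0) := by
    intro y hy
    have hr : Tendsto (fun n : ℕ ↦ √(1 - (n : ℝ)⁻¹ ^ 2) • y) atTop (𝓝 y) := by
      have h1 : Tendsto (fun n : ℕ ↦ √(1 - (n : ℝ)⁻¹ ^ 2)) atTop (𝓝 1) := by
        simpa using ((tendsto_inv_atTop_nhds_zero_nat (𝕜 := ℝ)).pow 2).const_sub 1 |>.sqrt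
      simpa using h1.smul_const y
    have hout := hr.eventually (Metric.isClosed_cthickening.isOpen_compl.mem_nhds hy)
    rw [tendsto_order]
    refine ⟨fun a ha ↦ Eventually.of_forall fun n ↦ ha.trans_le (hG n _).1, fun a ha ↦ ?_⟩
    obtain ⟨N, hNa, hN0⟩ := ((tendsto_gaussCDF_atBot.comp tendsto_neg_atTop_atBot).eventually_lt_const
      ha |>.and (eventually_ge_atTop 0)).exists
    filter_upwards [hout, tendsto_natCast_atTop_atTop.eventually (eventually_tail_le E ht hρ N hN0),
      eventually_gt_atTop 0] with n hn1 hn2 hn3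
    have h1 := (hsmooth n (by exact_mod_cast hn3) _ hn1).trans hn2
    have h2 := gaussShift_mono (t * n) h1
    rw [gaussShift_gaussCDF] at h2
    refine h2.trans_lt ?_
    convert hNa using 3
    simp
  have hle : ∀ᶠ n : ℕ in atTop, gaussShift t ((stdGaussian E).real A)
      ≤ (stdGaussian E).real S
        + ∫ y, Sᶜ.indicator (fun y ↦ G n (√(1 - (n : ℝ)⁻¹ ^ 2) • y)) y ∂stdGaussian E := by
    filter_upwards [eventually_ge_atTop 1] with n hn
    have h1 := gaussShift_integral_le ht (b := n) (by exact_mod_cast hn) hfm hf01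
    rw [hfint] at h1
    refine h1.trans ?_
    have hi : Integrable (fun y ↦ G n (√(1 - (n : ℝ)⁻¹ ^ 2) • y)) (stdGaussian E) :=
      integrable_of_mem_Icc ((hGm n).comp (by fun_prop)) fun _ ↦ hG n _
    have hSint : ∫ y, S.indicator (fun _ ↦ (1 : ℝ)) y ∂stdGaussian E = (stdGaussian E).real S := by
      rw [integral_indicator_const _ hS, smul_eq_mul, mul_one]
    rw [← hSint, ← integral_add ((integrable_const _).indicator hS) (hi.indicator hS.compl)]
    refine integral_mono hi (((integrable_const _).indicator hS).add (hi.indicator hS.compl))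
      fun y ↦ ?_
    by_cases hy : y ∈ S
    · simpa [hy] using (hG n _).2
    · simp [hy, G]
  have hlim : Tendsto (fun n : ℕ ↦ (stdGaussian E).real S
      + ∫ y, Sᶜ.indicator (fun y ↦ G n (√(1 - (n : ℝ)⁻¹ ^ 2) • y)) y ∂stdGaussian E) atTop
      (𝓝 ((stdGaussian E).real S + ∫ _, (0 : ℝ) ∂stdGaussian E)) := by
    refine Tendsto.const_add _ (tendsto_integral_of_dominated_convergence (fun _ ↦ 1) (fun n ↦ ?_)
      (integrable_const 1) (fun n ↦ ae_of_all _ fun y ↦ ?_) (ae_of_all _ fun y ↦ ?_))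
    · exact (((hGm n).comp (by fun_prop)).indicator hS.compl).aestronglyMeasurable
    · refine (norm_indicator_le_norm_self _ _).trans ?_
      rw [Real.norm_eq_abs, abs_of_nonneg (hG n _).1]
      exact (hG n _).2
    · by_cases hy : y ∈ S
      · simp [hy]
      · simpa [hy] using hzero y hy
  simpa using ge_of_tendsto hlim hle

/-- **Gaussian isoperimetric inequality**: the neighbourhoods of a measurable set have at least
the mass of those of a half-space of the same mass. -/
theorem gaussShift_le_measureReal_thickening {A : Set E} (hA : MeasurableSet A) {t : ℝ}
    (ht : 0 < t) :
    gaussShift t ((stdGaussian E).real A) ≤ (stdGaussian E).real (Metric.thickening t A) := by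
  have h1 : ∀ᶠ s in 𝓝[<] t, gaussShift s ((stdGaussian E).real A)
      ≤ (stdGaussian E).real (Metric.thickening t A) := by
    filter_upwards [Ioo_mem_nhdsLT ht] with s hs
    obtain ⟨ρ, hρ1, hρ2⟩ := exists_between hs.2
    exact (gaussShift_le_measureReal_cthickening hA hs.1.le hρ1).trans
      (measureReal_mono (Metric.cthickening_subset_thickening' ht hρ2 A))
  exact le_of_tendsto ((continuous_gaussShift_left _).continuousWithinAt) h1

end Isoperimetry

/-! ### Adversarial risk under a generative model -/

section Robustness

variable {X : Type*} [MeasurableSpace X] {K d : ℕ}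

lemma sub_le_measureReal_inter {α : Type*} [MeasurableSpace α] {ν : Measure α}
    [IsProbabilityMeasure ν] {A G : Set α} (hA : MeasurableSet A) {δ : ℝ} (hG : 1 - δ ≤ ν.real G) :
    ν.real A - δ ≤ ν.real (G ∩ A) := by
  have h1 := measureReal_inter_add_sdiff (μ := ν) (s := G) hA
  have h2 : ν.real (G \ A) ≤ ν.real Aᶜ := measureReal_mono fun x hx ↦ hx.2
  rw [probReal_compl_eq_one_sub hA] at h2
  linarith

/-- Under a locally Lipschitz generator, the adversarial risk dominates the isoperimetric profile
of the risk, up to the failure probability of the Lipschitz property. -/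
lemma gaussShift_sub_le_condLaw [MetricSpace X] {g : EuclideanSpace ℝ (Fin d) → X}
    (hg : Measurable g) {r L δ ε η : ℝ} (hL : LocallyLipschitzWithProb g r L δ) (hL0 : 0 < L)
    (hrL : ε ≤ r * L) (hη : 0 < η) (hηL : η ≤ ε / L) {B : Set X} (hB : MeasurableSet B) :
    gaussShift η ((condLaw g).real B) - δ
      ≤ (condLaw g).real {x | ∃ x' ∈ Metric.closedBall x ε, x' ∈ B} := by
  have hpre : (condLaw g).real B = (latentLaw d).real (g ⁻¹' B) := by
    rw [condLaw, map_measureReal_apply hg hB]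
  set S := {x | ∃ x' ∈ Metric.closedBall x ε, x' ∈ B}
  have : IsProbabilityMeasure (condLaw g) := Measure.isProbabilityMeasure_map hg.aemeasurable
  have h1 : (latentLaw d).real (g ⁻¹' S) ≤ (condLaw g).real S :=
    ENNReal.toReal_mono (measure_ne_top _ _) (Measure.le_map_apply hg.aemeasurable S)
  have h2 := gaussShift_le_measureReal_thickening (hg hB) hη
  have h3 := sub_le_measureReal_inter (ν := latentLaw d)
    (Metric.isOpen_thickening (δ := η) (E := g ⁻¹' B)).measurableSet hL
  refine le_trans (sub_le_sub_right (hpre ▸ h2) δ) (h3.trans (le_trans (measureReal_mono ?_) h1))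
  rintro z ⟨hz, hzB⟩
  obtain ⟨z', hz'B, hz'⟩ := Metric.mem_thickening_iff.1 hzB
  have h4 : dist z' z ≤ ε / L := by rw [dist_comm]; exact (hz'.trans_le hηL).le
  have h5 : dist z' z ≤ r := h4.trans (by rwa [div_le_iff₀ hL0])
  refine ⟨g z', ?_, hz'B⟩
  rw [Metric.mem_closedBall]
  refine (hz z' h5).trans ?_
  rw [← dist_eq_norm, mul_comm]
  exact (le_div_iff₀ hL0).1 h4

lemma IsGeneratedBy.measureReal_eq {μ : Measure X} {g : Fin K → EuclideanSpace ℝ (Fin d) → X}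
    {p : Fin K → ℝ} (h : IsGeneratedBy μ g p) (S : Set X) :
    μ.real S = ∑ i, p i * (condLaw (g i)).real S := by
  have hprob : ∀ i, IsProbabilityMeasure (condLaw (g i)) := fun i ↦
    Measure.isProbabilityMeasure_map (h.measurable i).aemeasurable
  rw [measureReal_def, h.eq_mixture, Measure.finsetSum_apply, ENNReal.toReal_sum]
  · refine Finset.sum_congr rfl fun i _ ↦ ?_
    rw [Measure.smul_apply, smul_eq_mul, ENNReal.toReal_mul, ENNReal.toReal_ofReal (h.nonneg i),
      measureReal_def]
  · intro i _
    exact ENNReal.mul_ne_top ENNReal.ofReal_ne_top (measure_ne_top _ _)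

lemma intrinsicRob_le [MetricSpace X] {μ : Measure X} {fstar : X → Fin K} {ε δ b : ℝ}
    {F : Set (X → Fin K)} (h : ∀ f ∈ F, b - δ ≤ advRisk μ fstar ε f) :
    intrinsicRob μ fstar ε F ≤ ((1 + δ - b : ℝ) : EReal) := by
  have h1 : ((b - δ : ℝ) : EReal) ≤ ⨅ f ∈ F, (advRisk μ fstar ε f : EReal) :=
    le_iInf₂ fun f hf ↦ by exact_mod_cast h f hf
  refine (EReal.sub_le_sub le_rfl h1).trans (le_of_eq ?_)
  rw [← EReal.coe_one, ← EReal.coe_sub]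
  congr 1
  ring

/-- Concentrating the error on a single class minimizes a sum of isoperimetric profiles. -/
lemma iInf_mul_gaussShift_le_sum {η α : ℝ} (hη : 0 ≤ η) (hα : 0 < α) {p a : Fin K → ℝ}
    (hp : ∀ i, 0 < p i ∧ α / p i ≤ 1) (ha : ∀ i, 0 ≤ a i) (h : α ≤ ∑ i, p i * a i) :
    ⨅ i, p i * gaussShift η (α / p i) ≤ ∑ i, p i * gaussShift η (a i) := by
  have hle : ∀ i, ⨅ i, p i * gaussShift η (α / p i) ≤ p i * gaussShift η (α / p i) := fun i ↦
    ciInf_le (Set.finite_range _).bddBelow i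
  have h0 : 0 ≤ ⨅ i, p i * gaussShift η (α / p i) :=
    Real.iInf_nonneg fun i ↦ mul_nonneg (hp i).1.le (gaussShift_nonneg _ _)
  set m := ⨅ i, p i * gaussShift η (α / p i)
  have hterm : ∀ i, 0 ≤ p i * gaussShift η (a i) := fun i ↦
    mul_nonneg (hp i).1.le (gaussShift_nonneg _ _)
  by_cases hex : ∃ i, α ≤ p i * a i
  · obtain ⟨i, hi⟩ := hex
    calc m ≤ p i * gaussShift η (α / p i) := hle i
      _ ≤ p i * gaussShift η (a i) := by
        refine mul_le_mul_of_nonneg_left (gaussShift_mono η ?_) (hp i).1.le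
        rw [div_le_iff₀ (hp i).1, mul_comm]; exact hi
      _ ≤ _ := Finset.single_le_sum (fun j _ ↦ hterm j) (Finset.mem_univ i)
  · push Not at hex
    have hi : ∀ i, p i * a i / α * m ≤ p i * gaussShift η (a i) := fun i ↦ by
      have hl : p i * a i / α ∈ Icc (0 : ℝ) 1 :=
        ⟨div_nonneg (mul_nonneg (hp i).1.le (ha i)) hα.le, (div_le_one hα).2 (hex i).le⟩
      have h1 := mul_gaussShift_le hη hl
        (⟨div_nonneg hα.le (hp i).1.le, (hp i).2⟩ : α / p i ∈ Icc (0 : ℝ) 1)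
      have hpi := (hp i).1.ne'
      have e : p i * a i / α * (α / p i) = a i := by field_simp
      rw [e] at h1
      have h2 := mul_le_mul_of_nonneg_left (hle i) hl.1
      have h3 := mul_le_mul_of_nonneg_left h1 (hp i).1.le
      linarith
    calc m ≤ (∑ i, p i * a i) / α * m :=
          le_mul_of_one_le_left h0 ((one_le_div hα).2 h)
      _ = ∑ i, p i * a i / α * m := by rw [Finset.sum_div, Finset.sum_mul]
      _ ≤ _ := Finset.sum_le_sum fun i _ ↦ hi i

end Robustness

end IntrinsicRobustness

end

theorem theorem2 {X : Type*} [MetricSpace X] [MeasurableSpace X] {K d : ℕ}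
    (μ : Measure X) [IsProbabilityMeasure μ]
    (fstar : X → Fin K) (hfstar : Measurable fstar)
    (g : Fin K → EuclideanSpace ℝ (Fin d) → X) (p : Fin K → ℝ)
    (hμ : IntrinsicRobustness.IsGeneratedBy μ g p)
    (ε r δ : ℝ) (hε : 0 < ε) (hr : 0 < r) (hδ : 0 < δ) (hδ1 : δ ≤ 1)
    (L : Fin K → ℝ)
    (hL : ∀ i, IntrinsicRobustness.LocallyLipschitzWithProb (g i) r (L i) δ)
    (hrL : ∀ i, ε ≤ r * L i)
    (α : ℝ) (hα : 0 < α) :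
    ((∀ i, 0 < p i ∧ α / p i ≤ 1) →
      IntrinsicRobustness.intrinsicRob μ fstar ε (IntrinsicRobustness.imperfect μ fstar α) ≤
        ((1 + δ - ⨅ i, p i * IntrinsicRobustness.gaussCDF
          (IntrinsicRobustness.gaussQuantile (α / p i) + ((ε / ⨆ j, L j : ℝ) : EReal)) : ℝ) :
            EReal)) ∧
    IntrinsicRobustness.intrinsicRob μ fstar ε
        (IntrinsicRobustness.classwiseImperfect g fstar α) ≤
      ((1 + δ - ∑ i, p i * IntrinsicRobustness.gaussCDF
        (IntrinsicRobustness.gaussQuantile α + ((ε / ⨆ j, L j : ℝ) : EReal)) : ℝ) : EReal) := by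
  obtain ⟨i₀⟩ : Nonempty (Fin K) := by
    by_contra h
    have := not_nonempty_iff.1 h
    simpa using hμ.sum_eq_one
  have hL0 : ∀ i, 0 < L i := fun i ↦ by
    by_contra! h
    nlinarith [hrL i]
  have hsup : ∀ i, L i ≤ ⨆ j, L j := fun i ↦ le_ciSup (Set.finite_range L).bddAbove i
  have hsup0 : 0 < ⨆ j, L j := (hL0 i₀).trans_le (hsup i₀)
  set η : ℝ := ε / ⨆ j, L j with hη
  have hη0 : 0 < η := div_pos hε hsup0
  have key : ∀ f : X → Fin K, Measurable f →
      ∑ i, p i * IntrinsicRobustness.gaussShift η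
        (IntrinsicRobustness.risk (IntrinsicRobustness.condLaw (g i)) fstar f) - δ
      ≤ IntrinsicRobustness.advRisk μ fstar ε f := by
    intro f hf
    have hB : MeasurableSet {x | f x ≠ fstar x} := (measurableSet_eq_fun hf hfstar).compl
    rw [IntrinsicRobustness.advRisk, hμ.measureReal_eq]
    have h1 := Finset.sum_le_sum fun i (_ : i ∈ Finset.univ) ↦ mul_le_mul_of_nonneg_left
      (IntrinsicRobustness.gaussShift_sub_le_condLaw (hμ.measurable i) (hL i) (hL0 i) (hrL i) hη0
        (div_le_div_of_nonneg_left hε.le (hL0 i) (hsup i)) hB) (hμ.nonneg i)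
    simp_rw [mul_sub, Finset.sum_sub_distrib, ← Finset.sum_mul, hμ.sum_eq_one, one_mul] at h1
    exact h1
  refine ⟨fun hp ↦ ?_, ?_⟩
  · refine IntrinsicRobustness.intrinsicRob_le fun f hf ↦ le_trans (sub_le_sub_right ?_ δ) (key f hf.1)
    refine IntrinsicRobustness.iInf_mul_gaussShift_le_sum hη0.le hα hp
      (fun i ↦ MeasureTheory.measureReal_nonneg) ?_
    have h := hf.2
    rwa [IntrinsicRobustness.risk, hμ.measureReal_eq] at h
  · refine IntrinsicRobustness.intrinsicRob_le fun f hf ↦ le_trans (sub_le_sub_right ?_ δ) (key f hf.1)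
    exact Finset.sum_le_sum fun i _ ↦ mul_le_mul_of_nonneg_left
      (IntrinsicRobustness.gaussShift_mono η (hf.2 i)) (hμ.nonneg i)
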